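/- Let $V$ be a complex vector space with a countably infinite basis $\widetilde E=\{e_i\}_{i\in I}$. A generalized flag in $V$ is a family $W=\{W_\alpha\}$ of subspaces indexed by a totally ordered set, with $W_\alpha\subsetneq W_\beta$ for $\alpha<\beta$, such that every index has an immediate predecessor or an immediate successor, and every nonzero $v\in V$ lies in $W_{\alpha''}\setminus W_{\alpha'}$ for some $\alpha'$ with immediate successor $\alpha''$. Let $W$ be a generalized flag such that every $W_\alpha$ is spanned by $\widetilde E\cap W_\alpha$, and assume that some $W_\alpha$ is different from $0$ and $V$. Let $V_*\subseteq V^*$ be the span of the dual system $\{e_i^*\}$. For each $\alpha$ let $U_\alpha$ be the span of $\widetilde E\setminus W_\alpha$, and let $(W_\alpha)_*$ be the span of the $e_i^*$ with $e_i\in W_\alpha$. Put $$V^W_{\widetilde E}=\bigcap_\alpha\bigl(((W_\alpha)_*)^*\oplus U_\alpha\bigr)\subseteq (V_*)^*,\qquad V^W_{*\widetilde E}=\bigcap_\alpha\bigl((W_\alpha)_*\oplus U_\alpha^*\bigr)\subseteq V^*,$$ where $\alpha$ runs over the indices with $0\ne W_\alpha\neq V$. These spaces are paired by $\langle x,y\rangle=\sum_i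 x(e_i^*)\,y(e_i)$, a sum with finitely many nonzero terms. Let $$G=\{\varphi\in GL(V^W_{\widetilde E})\mid \varphi^*(V^W_{*\widetilde E})=V^W_{*\widetilde E}\}$$ be the Mackey group of this pairing. It acts on subspaces $X\subseteq V$ by $\varphi\cdot X=\varphi(X^{\perp\perp})\cap V$, where $X^\perp\subseteq V^W_{*\widetilde E}$ and $X^{\perp\perp}\subseteq V^W_{\widetilde E}$. Let $St_W=\{\varphi\in G\mid \varphi\cdot W_\alpha=W_\alpha\text{ for all }\alpha\}$. Let $GL(\widetilde E,V)$ be the group of invertible operators on $V$ fixing all but finitely many elements of $\widetilde E$. Each such operator extends uniquely to an element of $G$, and so $GL(\widetilde E,V)$ is regarded as a subset of $G$. For an $I\times I$-matrix $M$ over $\mathbb C$, each $W_\alpha$ gives a splitting $M=\left(\begin{smallmatrix}A&B\\ C&D\end{smallmatrix}\right)$, the rows and columns with $e_i\in W_\alpha$ coming first. The matrix $M$ is called $W$-aligned if * $M$ has only finitely many nonzero entries strictly below the block diagonal, i.e. at positions $(i,j)$ such that $e_j\in W_\alpha$ and $e_i\notin W_\alpha$ for some $\alpha$; * for each $\alpha$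 with $0\neq W_\alpha\ne V$, every row of $A$ and every column of $D$ has only finitely many nonzero entries. A $W$-aligned matrix $M$ is called eligible if it has a $W$-aligned two-sided inverse $M^{-1}$ and if, for every $\alpha$, the lower-left blocks $C$ and $C'$ of $M$ and $M^{-1}$ satisfy $\mathrm{rk}\,C=\mathrm{rk}\,C'$. **Theorem.** The product set $GL(\widetilde E,V)\cdot St_W$ is a subgroup of $G$. The eligible $W$-aligned matrices form a group under matrix multiplication (all sums involved being finite). Assigning to an operator $\varphi$ its matrix $\bigl((\varphi(e_j))(e_i^*)\bigr)_{i,j}$ is an isomorphism from $GL(\widetilde E,V)\cdot St_W$ onto the group of all eligible $W$-aligned matrices. -/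

import Mathlib

open Module

noncomputable section

namespace GenFlag

/-- A generalized flag in `V`, with index set `A` ordered by inclusion of the subspaces: every index
has an immediate predecessor or an immediate successor, and every nonzero vector lies in
`W_{a''} \ W_{a'}` for some `a'` with immediate successor `a''`. -/
structure GeneralizedFlag (A V : Type*) [LinearOrder A] [AddCommGroup V] [Module ℂ V] where
  space : A → Submodule ℂ V
  strictMono : StrictMono space
  pred_or_succ : ∀ a : A, (∃ a' : A, a' ⋖ a) ∨ (∃ a' : A, a ⋖ a')
  exists_covBy : ∀ v : V, v ≠ 0 → ∃ a a' : A, a ⋖ a' ∧ v ∈ space a' ∧ v ∉ space a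

/-- `X` is a nonzero proper subspace. -/
def IsProperSub {V : Type*} [AddCommGroup V] [Module ℂ V] (X : Submodule ℂ V) : Prop :=
  X ≠ ⊥ ∧ X ≠ ⊤

/-- Every space of the flag is spanned by the basis vectors that it contains. -/
def GeneralizedFlag.Compatible {A ι V : Type*} [LinearOrder A] [AddCommGroup V] [Module ℂ V]
    (W : GeneralizedFlag A V) (b : Basis ι ℂ V) : Prop :=
  ∀ a, W.space a = Submodule.span ℂ ((W.space a : Set V) ∩ Set.range b)

/-- The flag is not just `{0, V}`: some member is a nonzero proper subspace. -/
def GeneralizedFlag.Nontriv {A V : Type*} [LinearOrder A] [AddCommGroup V] [Module ℂ V]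
    (W : GeneralizedFlag A V) : Prop :=
  ∃ a, IsProperSub (W.space a)

section Spaces

variable {ι V : Type*} [AddCommGroup V] [Module ℂ V]

/-- `GL(E, V)`: the invertible operators fixing all but finitely many basis vectors. -/
def finitaryGL (b : Basis ι ℂ V) : Subgroup (V ≃ₗ[ℂ] V) where
  carrier := {κ | {i | κ (b i) ≠ b i}.Finite}
  one_mem' := by simp
  mul_mem' := by
    intro κ κ' h h'
    refine (h.union h').subset ?_
    intro i hi
    by_contra hc
    simp only [Set.mem_union, Set.mem_ofPred_eq, not_or, not_not] at hc
    exact hi (by rw [LinearEquiv.mul_apply, hc.2, hc.1])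
  inv_mem' := by
    intro κ h
    refine h.subset ?_
    intro i hi hc
    apply hi
    have : κ⁻¹ (κ (b i)) = b i := κ.symm_apply_apply (b i)
    rwa [hc] at this

/-- `V_*`: the span, inside `V^*`, of the linear functions dual to the basis. -/
def dualSpan (b : Basis ι ℂ V) : Submodule ℂ (Dual ℂ V) :=
  Submodule.span ℂ (Set.range b.coord)

/-- The `i`-th dual basis function, as an element of `V_*`. -/
def dualVec (b : Basis ι ℂ V) (i : ι) : dualSpan b :=
  ⟨b.coord i, Submodule.subset_span ⟨i, rfl⟩⟩

/-- The canonical embedding of `V` into `(V_*)^*` by evaluation. -/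
def evalV (b : Basis ι ℂ V) : V →ₗ[ℂ] Dual ℂ (dualSpan b) :=
  (dualSpan b).subtype.dualMap ∘ₗ Dual.eval ℂ V

/-- The complement `U` of a coordinate subspace `X`, spanned by the basis vectors not in `X`. -/
def compl (b : Basis ι ℂ V) (X : Submodule ℂ V) : Submodule ℂ V :=
  Submodule.span ℂ (b '' {i | b i ∉ X})

/-- `(X_*)^* ⊕ U`, inside `(V_*)^*`. Here `V_* = X_* ⊕ U_*`, so that `(X_*)^*` consists of the
functionals on `V_*` that vanish on `U_*`. -/
def bigSpace (b : Basis ι ℂ V) (X : Submodule ℂ V) : Submodule ℂ (Dual ℂ (dualSpan b)) :=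
  (Submodule.span ℂ (dualVec b '' {i | b i ∉ X})).dualAnnihilator ⊔ (compl b X).map (evalV b)

/-- `X_* ⊕ U^*`, inside `V^*`. Here `V = X ⊕ U`, so that `U^*` consists of the functionals
on `V` that vanish on `X`. -/
def bigDual (b : Basis ι ℂ V) (X : Submodule ℂ V) : Submodule ℂ (Dual ℂ V) :=
  Submodule.span ℂ (b.coord '' {i | b i ∈ X}) ⊔ X.dualAnnihilator

lemma evalV_apply (b : Basis ι ℂ V) (v : V) (i : ι) : evalV b v (dualVec b i) = b.coord i v := rfl

lemma evalV_mem_bigSpace (b : Basis ι ℂ V) (X : Submodule ℂ V) (v : V) :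
    evalV b v ∈ bigSpace b X := by
  have hv : v ∈ Submodule.span ℂ (Set.range b) := b.mem_span v
  induction hv using Submodule.span_induction with
  | mem v hv =>
    obtain ⟨j, rfl⟩ := hv
    by_cases hj : b j ∈ X
    · refine Submodule.mem_sup_left ?_
      rw [Submodule.mem_dualAnnihilator]
      intro y hy
      induction hy using Submodule.span_induction with
      | mem y hy =>
        obtain ⟨i, hi, rfl⟩ := hy
        have hij : j ≠ i := by rintro rfl; exact hi hj
        rw [evalV_apply, Basis.coord_apply, Basis.repr_self, Finsupp.single_eq_of_ne' hij]
      | zero => simp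
      | add x y _ _ hx hy => rw [map_add, hx, hy, add_zero]
      | smul c x _ hx => rw [map_smul, hx, smul_zero]
    · exact Submodule.mem_sup_right ⟨b j, Submodule.subset_span ⟨j, hj, rfl⟩, rfl⟩
  | zero => simp
  | add x y _ _ hx hy => rw [map_add]; exact Submodule.add_mem _ hx hy
  | smul c x _ hx => rw [map_smul]; exact Submodule.smul_mem _ c hx

/-- Off `X`, an element of `(X_*)^* ⊕ U` has finitely many nonzero coordinates. -/
lemma finite_of_mem_bigSpace (b : Basis ι ℂ V) {X : Submodule ℂ V} {x : Dual ℂ (dualSpan b)}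
    (hx : x ∈ bigSpace b X) : {i | b i ∉ X ∧ x (dualVec b i) ≠ 0}.Finite := by
  obtain ⟨w, hw, _, ⟨u, -, rfl⟩, rfl⟩ := Submodule.mem_sup.1 hx
  refine (b.repr u).hasFiniteSupport.subset ?_
  rintro i ⟨hi, hne⟩
  rw [Submodule.mem_dualAnnihilator] at hw
  rw [LinearMap.add_apply, hw _ (Submodule.subset_span ⟨i, hi, rfl⟩), zero_add, evalV_apply] at hne
  exact hne

/-- On `X`, an element of `X_* ⊕ U^*` has finitely many nonzero coordinates. -/
lemma finite_of_mem_bigDual (b : Basis ι ℂ V) {X : Submodule ℂ V} {y : Dual ℂ V}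
    (hy : y ∈ bigDual b X) : {i | b i ∈ X ∧ y (b i) ≠ 0}.Finite := by
  obtain ⟨w, hw, u, hu, hwu⟩ := Submodule.mem_sup.1 hy
  rw [Submodule.mem_dualAnnihilator] at hu
  have hfin : {i | w (b i) ≠ 0}.Finite := by
    clear hwu
    induction hw using Submodule.span_induction with
    | mem w hw =>
      obtain ⟨j, -, rfl⟩ := hw
      refine (Set.finite_singleton j).subset ?_
      intro i hi
      by_contra hij
      apply hi
      rw [Basis.coord_apply, Basis.repr_self, Finsupp.single_eq_of_ne' hij]
    | zero => simp
    | add x y _ _ hx hy =>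
      refine (hx.union hy).subset ?_
      intro i hi
      by_contra hc
      simp only [Set.mem_union, Set.mem_ofPred_eq, not_or, not_not] at hc
      exact hi (by rw [LinearMap.add_apply, hc.1, hc.2, add_zero])
    | smul c x _ hx =>
      refine hx.subset ?_
      intro i hi hc
      exact hi (by rw [LinearMap.smul_apply, hc, smul_zero])
  refine hfin.subset ?_
  rintro i ⟨hi, hne⟩
  rw [← hwu, LinearMap.add_apply, hu _ hi, add_zero] at hne
  exact hne

end Spaces

section Mackey

variable {T R : Type*} [AddCommGroup T] [Module ℂ T] [AddCommGroup R] [Module ℂ R]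

/-- The Mackey group `G(T, R) = {φ ∈ GL(T) | φ^*(R) = R}` of a pairing `p`, where `R` is seen inside
`T^*` through `p`. -/
def mackeyGroup (p : T →ₗ[ℂ] R →ₗ[ℂ] ℂ) : Subgroup (T ≃ₗ[ℂ] T) where
  carrier := {φ | (LinearMap.range p.flip).map φ.toLinearMap.dualMap = LinearMap.range p.flip}
  one_mem' := Submodule.map_id _
  mul_mem' := by
    intro φ ψ hφ hψ
    have h : (φ * ψ).toLinearMap.dualMap = ψ.toLinearMap.dualMap ∘ₗ φ.toLinearMap.dualMap := rfl
    simp only [Set.mem_ofPred_eq] at hφ hψ ⊢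
    rw [h, Submodule.map_comp, hφ, hψ]
  inv_mem' := by
    intro φ hφ
    simp only [Set.mem_ofPred_eq] at hφ ⊢
    have h : (φ⁻¹).toLinearMap.dualMap ∘ₗ φ.toLinearMap.dualMap = LinearMap.id := by
      ext f x
      exact congrArg f (φ.apply_symm_apply x)
    conv_lhs => rw [← hφ]
    rw [← Submodule.map_comp, h, Submodule.map_id]

/-- The annihilator in `R` of a subspace of `T`. -/
def perpRight (p : T →ₗ[ℂ] R →ₗ[ℂ] ℂ) (X : Submodule ℂ T) : Submodule ℂ R :=
  X.dualAnnihilator.comap p.flip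

/-- The annihilator in `T` of a subspace of `R`. -/
def perpLeft (p : T →ₗ[ℂ] R →ₗ[ℂ] ℂ) (Y : Submodule ℂ R) : Submodule ℂ T :=
  Y.dualAnnihilator.comap p

end Mackey

section FlagGroup

variable {A ι V : Type*} [LinearOrder A] [AddCommGroup V] [Module ℂ V]

/-- `V^W_E = ⋂_a ((W_a)_*)^* ⊕ U_a`, over the nonzero proper members of the flag. -/
def VE (W : GeneralizedFlag A V) (b : Basis ι ℂ V) : Submodule ℂ (Dual ℂ (dualSpan b)) :=
  ⨅ (a : A) (_ : IsProperSub (W.space a)), bigSpace b (W.space a)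

/-- `V^W_{*E} = ⋂_a (W_a)_* ⊕ U_a^*`, over the nonzero proper members of the flag. -/
def VEdual (W : GeneralizedFlag A V) (b : Basis ι ℂ V) : Submodule ℂ (Dual ℂ V) :=
  ⨅ (a : A) (_ : IsProperSub (W.space a)), bigDual b (W.space a)

/-- The embedding of `V` into `V^W_E`. -/
def incl (W : GeneralizedFlag A V) (b : Basis ι ℂ V) : V →ₗ[ℂ] VE W b :=
  (evalV b).codRestrict (VE W b) fun v => by
    simp only [VE, Submodule.mem_iInf]
    exact fun a _ => evalV_mem_bigSpace b _ v

lemma pairing_finite (W : GeneralizedFlag A V) (b : Basis ι ℂ V) (hW : W.Nontriv)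
    (x : VE W b) (y : VEdual W b) :
    (Function.support fun i => x.1 (dualVec b i) * y.1 (b i)).Finite := by
  obtain ⟨a, ha⟩ := hW
  have hx : x.1 ∈ bigSpace b (W.space a) := by
    have := x.2
    simp only [VE, Submodule.mem_iInf] at this
    exact this a ha
  have hy : y.1 ∈ bigDual b (W.space a) := by
    have := y.2
    simp only [VEdual, Submodule.mem_iInf] at this
    exact this a ha
  refine ((finite_of_mem_bigSpace b hx).union (finite_of_mem_bigDual b hy)).subset ?_
  intro i hi
  rw [Function.mem_support] at hi
  by_cases h : b i ∈ W.space a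
  · exact Or.inr ⟨h, right_ne_zero_of_mul hi⟩
  · exact Or.inl ⟨h, left_ne_zero_of_mul hi⟩

/-- The canonical pairing `V^W_E × V^W_{*E} → ℂ`. In coordinates it is `∑ i, x(e_i^*) y(e_i)`,
a sum with finitely many nonzero terms; for `x = ω + u` and `y = w + μ` decomposed along a member
`W_a` of the flag, it is `ω(w) + μ(u)`. -/
def pairing (W : GeneralizedFlag A V) (b : Basis ι ℂ V) (hW : W.Nontriv) :
    VE W b →ₗ[ℂ] VEdual W b →ₗ[ℂ] ℂ :=
  LinearMap.mk₂ ℂ (fun x y => ∑ᶠ i, x.1 (dualVec b i) * y.1 (b i))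
    (by
      intro x x' y
      rw [← finsum_add_distrib (pairing_finite W b hW x y) (pairing_finite W b hW x' y)]
      exact finsum_congr fun i => add_mul _ _ _)
    (by
      intro c x y
      rw [smul_eq_mul, mul_finsum' _ _ (pairing_finite W b hW x y)]
      exact finsum_congr fun i => mul_assoc _ _ _)
    (by
      intro x y y'
      rw [← finsum_add_distrib (pairing_finite W b hW x y) (pairing_finite W b hW x y')]
      exact finsum_congr fun i => mul_add _ _ _)
    (by
      intro c x y
      rw [smul_eq_mul, mul_finsum' _ _ (pairing_finite W b hW x y)]
      exact finsum_congr fun i => mul_left_comm _ _ _)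

/-- The Mackey group `G(V^W_E, V^W_{*E})`. -/
abbrev flagMackey (W : GeneralizedFlag A V) (b : Basis ι ℂ V) (hW : W.Nontriv) :
    Subgroup (VE W b ≃ₗ[ℂ] VE W b) :=
  mackeyGroup (pairing W b hW)

/-- The action `X ↦ φ((X^⊥)^⊥) ∩ V` of the Mackey group on subspaces of `V`. -/
def act (W : GeneralizedFlag A V) (b : Basis ι ℂ V) (hW : W.Nontriv) (φ : flagMackey W b hW)
    (X : Submodule ℂ V) : Submodule ℂ V :=
  ((perpLeft (pairing W b hW) (perpRight (pairing W b hW) (X.map (incl W b)))).map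
    (φ : VE W b ≃ₗ[ℂ] VE W b).toLinearMap).comap (incl W b)

/-- `St_W`: the elements of the Mackey group that stabilize the indexed chain `W`. -/
def stab (W : GeneralizedFlag A V) (b : Basis ι ℂ V) (hW : W.Nontriv) :
    Set (flagMackey W b hW) :=
  {φ | ∀ a, act W b hW φ (W.space a) = W.space a}

/-- `φ` is the operator `κ`, regarded as an element of the Mackey group. -/
def Extends (W : GeneralizedFlag A V) (b : Basis ι ℂ V) (hW : W.Nontriv)
    (φ : flagMackey W b hW) (κ : V ≃ₗ[ℂ] V) : Prop :=
  ∀ v, (φ : VE W b ≃ₗ[ℂ] VE W b) (incl W b v) = incl W b (κ v)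

/-- `GL(E, V) · St_W`, the product being taken in the Mackey group. -/
def productSet (W : GeneralizedFlag A V) (b : Basis ι ℂ V) (hW : W.Nontriv) :
    Set (flagMackey W b hW) :=
  {φ | ∃ k s : flagMackey W b hW,
    (∃ κ ∈ finitaryGL b, Extends W b hW k κ) ∧ s ∈ stab W b hW ∧ φ = k * s}

/-- The matrix of an element of the Mackey group: the entry `(i, j)` is the `i`-th coordinate of
the image of the `j`-th basis vector. -/
def matrixOf (W : GeneralizedFlag A V) (b : Basis ι ℂ V) (hW : W.Nontriv)
    (φ : flagMackey W b hW) : Matrix ι ι ℂ :=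
  Matrix.of fun i j => ((φ : VE W b ≃ₗ[ℂ] VE W b) (incl W b (b j))).1 (dualVec b i)

end FlagGroup

section Matrices

/-- The product of two infinite matrices (to be used when all the sums are finite). -/
def mulMat {ι : Type*} (M N : Matrix ι ι ℂ) : Matrix ι ι ℂ :=
  Matrix.of fun i k => ∑ᶠ j, M i j * N j k

open Classical in
/-- The identity matrix. -/
def idMat (ι : Type*) : Matrix ι ι ℂ := 1

variable {A ι V : Type*} [LinearOrder A] [AddCommGroup V] [Module ℂ V]

/-- The position `(i, j)` lies strictly below the block diagonal: the `j`-th basis vector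
comes strictly earlier in the flag than the `i`-th one. -/
def IsBelow (W : GeneralizedFlag A V) (b : Basis ι ℂ V) (i j : ι) : Prop :=
  ∃ a, b j ∈ W.space a ∧ b i ∉ W.space a

/-- `W`-aligned matrices: finitely many nonzero entries strictly below the block diagonal, and in the
splitting `(A B; C D)` given by any nonzero proper member of the flag, `A` has finitary rows and
`D` has finitary columns. -/
def Aligned (W : GeneralizedFlag A V) (b : Basis ι ℂ V) (M : Matrix ι ι ℂ) : Prop :=
  {q : ι × ι | IsBelow W b q.1 q.2 ∧ M q.1 q.2 ≠ 0}.Finite ∧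
  ∀ a, IsProperSub (W.space a) →
    (∀ i, b i ∈ W.space a → {j | b j ∈ W.space a ∧ M i j ≠ 0}.Finite) ∧
    (∀ j, b j ∉ W.space a → {i | b i ∉ W.space a ∧ M i j ≠ 0}.Finite)

/-- The lower left block `C` of the splitting of `M` given by `W_a`. -/
def lowerBlock (W : GeneralizedFlag A V) (b : Basis ι ℂ V) (a : A) (M : Matrix ι ι ℂ) :
    Matrix {i : ι // b i ∉ W.space a} {j : ι // b j ∈ W.space a} ℂ :=
  M.submatrix Subtype.val Subtype.val

/-- Eligible matrices: `M` is aligned, has an aligned (two-sided) inverse `N`, and the blocks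
`C` of `M` and `C'` of `N` have the same rank for every member of the flag. -/
def Eligible (W : GeneralizedFlag A V) (b : Basis ι ℂ V) (M : Matrix ι ι ℂ) : Prop :=
  Aligned W b M ∧ ∃ N, Aligned W b N ∧ mulMat M N = idMat ι ∧ mulMat N M = idMat ι ∧
    ∀ a, (lowerBlock W b a M).cRank = (lowerBlock W b a N).cRank

/-- The type of eligible matrices. -/
def EligibleMatrix (W : GeneralizedFlag A V) (b : Basis ι ℂ V) : Type _ :=
  {M : Matrix ι ι ℂ // Eligible W b M}

end Matrices

end GenFlag

end

/-!
In coordinates, `V^W_E` consists of the sequences `x : ι → ℂ` that are finitely supported outside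
every nonzero proper `W_a`, and `V^W_{*E}` of the sequences that are finitely supported on every
such `W_a` (`exists_coordV_eq`, `exists_coordD_eq`). An element of the Mackey group is therefore
determined by its matrix, whose rows lie in `V^W_{*E}` and whose columns lie in `V^W_E`, and
composition becomes the matrix product (`exists_row`, `matrixOf_injective`, `matrixOf_mul`).
Conversely, multiplication by an aligned matrix is an operator on `V^W_E` with an adjoint on
`V^W_{*E}`, so that every aligned matrix with an aligned inverse comes from the Mackey group
(`Aligned.exists_matrixOf_eq`). The finitary operators of `V` extend for this reason.

Write `closed a` for `W_a^{⊥⊥}`, the sequences in `V^W_E` that vanish outside `W_a`. The stabilizer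
of the flag consists of the `φ` with `φ (closed a) = closed a` for all `a` (`mem_stab_iff`), hence
of block upper triangular matrices. It remains to see that `φ` lies in `GL(E, V) · St_W` if and only
if its matrix is eligible (`mem_productSet_iff`).

Let the matrices of `φ` and `φ⁻¹` be aligned, and let `S` be a finite set containing the row and
column indices of all their nonzero entries below the block diagonal. With `F` the span of the basis
vectors in `S`, the space `φ (closed a)` is the sum of `F ∩ φ (closed a)` and of the elements of
`closed a` that vanish on `S`. The lower left blocks of `φ` and `φ⁻¹` then have as ranks the
codimensions of `F ∩ W_a ∩ φ (closed a)` in `F ∩ φ (closed a)` and in `F ∩ W_a`, so that they agree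
precisely when `F ∩ W_a` and `F ∩ φ (closed a)` have the same dimension (`Adapted.cRank_eq_iff`).
If `φ = k s` with `k` finitary and `s` in the stabilizer, and `k` lives on `S`, then `k` maps the
first space onto the second. Conversely, if all these dimensions agree, then some automorphism of
`F` maps the first flag to the second (`exists_equiv_map_flag`); extended by the identity it gives
a finitary `k` with `k (closed a) = φ (closed a)` for all `a`, and `k⁻¹ φ` is in the stabilizer.

Eligibility is invariant under inversion, so `GL(E, V) · St_W = St_W · GL(E, V)`, which makes the
product set a subgroup; the group structure on the eligible matrices is transported from it.
-/

noncomputable section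

namespace GenFlag

/-! ### Coordinates on the two completions -/

section Coordinates

variable {A ι V : Type*} [LinearOrder A] [AddCommGroup V] [Module ℂ V]
  (W : GeneralizedFlag A V) (b : Basis ι ℂ V)

/-- The coordinate sequence `i ↦ x(e_i^*)` of an element of `V^W_E`. -/
def coordV : VE W b →ₗ[ℂ] (ι → ℂ) :=
  LinearMap.pi fun i => (LinearMap.applyₗ (dualVec b i)) ∘ₗ (VE W b).subtype

/-- The coordinate sequence `i ↦ y(e_i)` of an element of `V^W_{*E}`. -/
def coordD : VEdual W b →ₗ[ℂ] (ι → ℂ) :=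
  LinearMap.pi fun i => (LinearMap.applyₗ (b i)) ∘ₗ (VEdual W b).subtype

variable {W b}

lemma pairing_apply (hW : W.Nontriv) (x : VE W b) (y : VEdual W b) :
    pairing W b hW x y = ∑ᶠ i, coordV W b x i * coordD W b y i := rfl

/-- The dual system as a basis of its span `V_*`. -/
def dualSpanBasis (b : Basis ι ℂ V) : Basis ι ℂ (dualSpan b) :=
  Basis.span b.linearIndependent_coord

lemma dualSpanBasis_apply (b : Basis ι ℂ V) (i : ι) : dualSpanBasis b i = dualVec b i :=
  Basis.span_apply _ i

lemma coordV_injective : Function.Injective (coordV W b) := by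
  intro x y h
  apply Subtype.ext
  refine (dualSpanBasis b).ext fun i => ?_
  rw [dualSpanBasis_apply]
  exact congrFun h i

lemma coordV_incl (v : V) (i : ι) : coordV W b (incl W b v) i = b.repr v i := rfl

open Classical in
lemma coordV_incl_basis (i j : ι) :
    coordV W b (incl W b (b j)) i = if j = i then 1 else 0 := by
  rw [coordV_incl, Basis.repr_self, Finsupp.single_apply]

/-- Off a proper member of the flag, elements of `V^W_E` have finitely many coordinates. -/
lemma coordV_finite (x : VE W b) {a : A} (ha : IsProperSub (W.space a)) :
    {i | b i ∉ W.space a ∧ coordV W b x i ≠ 0}.Finite := by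
  have := x.2
  simp only [VE, Submodule.mem_iInf] at this
  exact finite_of_mem_bigSpace b (this a ha)

/-- On a proper member of the flag, elements of `V^W_{*E}` have finitely many coordinates. -/
lemma coordD_finite (y : VEdual W b) {a : A} (ha : IsProperSub (W.space a)) :
    {i | b i ∈ W.space a ∧ coordD W b y i ≠ 0}.Finite := by
  have := y.2
  simp only [VEdual, Submodule.mem_iInf] at this
  exact finite_of_mem_bigDual b (this a ha)

lemma mem_bigSpace_of_finite (b : Basis ι ℂ V) (X : Submodule ℂ V) (x : Dual ℂ (dualSpan b))
    (hx : {i | b i ∉ X ∧ x (dualVec b i) ≠ 0}.Finite) : x ∈ bigSpace b X := by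
  classical
  set u : V := ∑ i ∈ hx.toFinset, x (dualVec b i) • b i with hu
  have hu' : u ∈ compl b X := by
    refine Submodule.sum_mem _ fun i hi => Submodule.smul_mem _ _ ?_
    rw [Set.Finite.mem_toFinset] at hi
    exact Submodule.subset_span ⟨i, hi.1, rfl⟩
  rw [← sub_add_cancel x (evalV b u)]
  refine Submodule.add_mem_sup ?_ ⟨u, hu', rfl⟩
  rw [Submodule.mem_dualAnnihilator]
  intro y hy
  have : Submodule.span ℂ (dualVec b '' {i | b i ∉ X}) ≤ LinearMap.ker (x - evalV b u) := by
    rw [Submodule.span_le]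
    rintro _ ⟨i, hi, rfl⟩
    simp only [SetLike.mem_coe, LinearMap.mem_ker, LinearMap.sub_apply]
    rw [evalV_apply, hu, map_sum, sub_eq_zero]
    simp only [map_smul, Basis.coord_apply, Basis.repr_self, Finsupp.single_apply, smul_eq_mul,
      mul_ite, mul_one, mul_zero, Finset.sum_ite_eq', Set.Finite.mem_toFinset,
      Set.mem_ofPred_eq]
    split_ifs with h
    · rfl
    · by_contra hne
      exact h ⟨hi, hne⟩
  exact this hy

lemma mem_bigDual_of_finite (b : Basis ι ℂ V) {X : Submodule ℂ V}
    (hX : X = Submodule.span ℂ ((X : Set V) ∩ Set.range b)) (y : Dual ℂ V)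
    (hy : {i | b i ∈ X ∧ y (b i) ≠ 0}.Finite) : y ∈ bigDual b X := by
  classical
  set w : Dual ℂ V := ∑ i ∈ hy.toFinset, y (b i) • b.coord i with hw
  have hw' : w ∈ Submodule.span ℂ (b.coord '' {i | b i ∈ X}) := by
    refine Submodule.sum_mem _ fun i hi => Submodule.smul_mem _ _ ?_
    rw [Set.Finite.mem_toFinset] at hi
    exact Submodule.subset_span ⟨i, hi.1, rfl⟩
  rw [← add_sub_cancel w y]
  refine Submodule.add_mem_sup hw' ?_
  rw [Submodule.mem_dualAnnihilator]
  intro v hv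
  have : X ≤ LinearMap.ker (y - w) := by
    conv_lhs => rw [hX]
    rw [Submodule.span_le]
    rintro _ ⟨hi, i, rfl⟩
    simp only [SetLike.mem_coe, LinearMap.mem_ker, LinearMap.sub_apply]
    rw [hw, LinearMap.sum_apply, sub_eq_zero]
    simp only [LinearMap.smul_apply, Basis.coord_apply, Basis.repr_self, Finsupp.single_apply,
      smul_eq_mul, mul_ite, mul_one, mul_zero, Finset.sum_ite_eq, Set.Finite.mem_toFinset,
      Set.mem_ofPred_eq]
    split_ifs with h
    · rfl
    · by_contra hne
      exact h ⟨hi, hne⟩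
  exact this hv

lemma exists_coordV_eq (f : ι → ℂ)
    (hf : ∀ a, IsProperSub (W.space a) → {i | b i ∉ W.space a ∧ f i ≠ 0}.Finite) :
    ∃ x : VE W b, coordV W b x = f := by
  have key : ∀ i, (dualSpanBasis b).constr ℂ f (dualVec b i) = f i := fun i => by
    rw [← dualSpanBasis_apply, Basis.constr_basis]
  refine ⟨⟨(dualSpanBasis b).constr ℂ f, ?_⟩, funext key⟩
  simp only [VE, Submodule.mem_iInf]
  intro a ha
  refine mem_bigSpace_of_finite b _ _ ?_
  simp only [key]
  exact hf a ha

lemma exists_coordD_eq (hb : W.Compatible b) (f : ι → ℂ)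
    (hf : ∀ a, IsProperSub (W.space a) → {i | b i ∈ W.space a ∧ f i ≠ 0}.Finite) :
    ∃ y : VEdual W b, coordD W b y = f := by
  have key : ∀ i, b.constr ℂ f (b i) = f i := fun i => by rw [Basis.constr_basis]
  refine ⟨⟨b.constr ℂ f, ?_⟩, funext key⟩
  simp only [VEdual, Submodule.mem_iInf]
  intro a ha
  refine mem_bigDual_of_finite b (hb a) _ ?_
  simp only [key]
  exact hf a ha

open Classical in
/-- The dual basis functions belong to `V^W_{*E}`. -/
lemma exists_coordD_eq_single (hb : W.Compatible b) (i : ι) :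
    ∃ y : VEdual W b, coordD W b y = Pi.single i 1 := by
  refine exists_coordD_eq hb _ fun a _ => (Set.finite_singleton i).subset ?_
  rintro j ⟨-, hj⟩
  by_contra h
  exact hj (Pi.single_eq_of_ne h _)

lemma pairing_single (hW : W.Nontriv) (x : VE W b) {y : VEdual W b} {f : ι → ℂ} {i : ι}
    (hy : coordD W b y = f) (hf : f i = 1) (hf' : ∀ j, j ≠ i → f j = 0) :
    pairing W b hW x y = coordV W b x i := by
  rw [pairing_apply, finsum_eq_single _ i, hy, hf, mul_one]
  intro j hj
  rw [hy, hf' j hj, mul_zero]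

lemma pairing_incl_basis (hW : W.Nontriv) (y : VEdual W b) (j : ι) :
    pairing W b hW (incl W b (b j)) y = coordD W b y j := by
  classical
  rw [pairing_apply, finsum_eq_single _ j, coordV_incl_basis, if_pos rfl, one_mul]
  intro i hi
  rw [coordV_incl_basis, if_neg (Ne.symm hi), zero_mul]

/-- An element of `V^W_E`, put as the `j`-th column of a matrix, has finitely many nonzero entries
strictly below the block diagonal. -/
lemma finite_isBelow_left (x : VE W b) (j : ι) :
    {i | IsBelow W b i j ∧ coordV W b x i ≠ 0}.Finite := by
  obtain ⟨a, a', haa, hj', hj⟩ := W.exists_covBy (b j) (b.ne_zero j)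
  have hsub : ∀ i, IsBelow W b i j → b i ∉ W.space a' := by
    rintro i ⟨c, hjc, hic⟩ hi
    have hac : a < c := by
      by_contra h
      exact hj (W.strictMono.monotone (not_lt.1 h) hjc)
    exact hic (W.strictMono.monotone (haa.ge_of_gt hac) hi)
  by_cases htop : W.space a' = ⊤
  · refine Set.finite_empty.subset ?_
    rintro i ⟨hi, -⟩
    exact hsub i hi (htop ▸ Submodule.mem_top)
  · have hbot : W.space a' ≠ ⊥ := by
      intro h
      rw [h, Submodule.mem_bot] at hj'
      exact b.ne_zero j hj'
    exact (coordV_finite x ⟨hbot, htop⟩).subset fun i hi => ⟨hsub i hi.1, hi.2⟩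

/-- An element of `V^W_{*E}`, put as the `i`-th row of a matrix, has finitely many nonzero entries
strictly below the block diagonal. -/
lemma finite_isBelow_right (y : VEdual W b) (i : ι) :
    {j | IsBelow W b i j ∧ coordD W b y j ≠ 0}.Finite := by
  obtain ⟨a, a', haa, hi', hi⟩ := W.exists_covBy (b i) (b.ne_zero i)
  have hsub : ∀ j, IsBelow W b i j → b j ∈ W.space a := by
    rintro j ⟨c, hjc, hic⟩
    have hac : c < a' := by
      by_contra h
      exact hic (W.strictMono.monotone (not_lt.1 h) hi')
    exact W.strictMono.monotone (haa.le_of_lt hac) hjc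
  by_cases hbot : W.space a = ⊥
  · refine Set.finite_empty.subset ?_
    rintro j ⟨hj, -⟩
    have := hsub j hj
    rw [hbot, Submodule.mem_bot] at this
    exact b.ne_zero j this
  · have htop : W.space a ≠ ⊤ := fun h => hi (h ▸ Submodule.mem_top)
    exact (coordD_finite y ⟨hbot, htop⟩).subset fun j hj => ⟨hsub j hj.1, hj.2⟩

lemma mem_space_iff_repr (hb : W.Compatible b) (a : A) (v : V) :
    v ∈ W.space a ↔ ∀ i, b i ∉ W.space a → b.repr v i = 0 := by
  have hset : ((W.space a : Set V) ∩ Set.range b) = b '' {i | b i ∈ W.space a} := by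
    ext v
    constructor
    · rintro ⟨hv, i, rfl⟩
      exact ⟨i, hv, rfl⟩
    · rintro ⟨i, hi, rfl⟩
      exact ⟨hi, i, rfl⟩
  have h : v ∈ W.space a ↔ v ∈ Submodule.span ℂ (b '' {i | b i ∈ W.space a}) := by
    rw [← hset, ← hb a]
  rw [h, Basis.mem_span_image]
  constructor
  · intro hv i hi
    by_contra hne
    exact hi (hv (Finsupp.mem_support_iff.2 hne))
  · intro hv i hi
    by_contra hne
    exact Finsupp.mem_support_iff.1 hi (hv i hne)

end Coordinates

/-! ### Elements of the Mackey group and their matrices -/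

section Operators

variable {A ι V : Type*} [LinearOrder A] [AddCommGroup V] [Module ℂ V]
  {W : GeneralizedFlag A V} {b : Basis ι ℂ V}

/-- The rows of the matrix of an element of the Mackey group are elements of `V^W_{*E}`: they are
the images of the dual basis functions under the adjoint. -/
lemma exists_row (hb : W.Compatible b) (hW : W.Nontriv) (φ : flagMackey W b hW) (i : ι) :
    ∃ y : VEdual W b, coordD W b y = matrixOf W b hW φ i ∧
      ∀ x, coordV W b (φ.1 x) i = pairing W b hW x y := by
  classical
  obtain ⟨y₀, hy₀⟩ := exists_coordD_eq_single hb i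
  have hφ : (LinearMap.range (pairing W b hW).flip).map φ.1.toLinearMap.dualMap =
    LinearMap.range (pairing W b hW).flip := φ.2
  have hmem : φ.1.toLinearMap.dualMap ((pairing W b hW).flip y₀) ∈
      LinearMap.range (pairing W b hW).flip := by
    rw [← hφ]
    exact Submodule.mem_map_of_mem ⟨y₀, rfl⟩
  obtain ⟨y, hy⟩ := hmem
  have key : ∀ x, coordV W b (φ.1 x) i = pairing W b hW x y := by
    intro x
    have h := congrArg (fun f : Dual ℂ (VE W b) => f x) hy
    change pairing W b hW x y = pairing W b hW (φ.1 x) y₀ at h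
    rw [h, pairing_single hW _ hy₀ (Pi.single_eq_same _ _)
      fun j hj => Pi.single_eq_of_ne hj _]
  refine ⟨y, funext fun j => ?_, key⟩
  rw [← pairing_incl_basis hW, ← key]
  rfl

lemma matrixOf_apply (hW : W.Nontriv) (φ : flagMackey W b hW) (i j : ι) :
    matrixOf W b hW φ i j = coordV W b (φ.1 (incl W b (b j))) i := rfl

lemma coordV_map (hb : W.Compatible b) (hW : W.Nontriv) (φ : flagMackey W b hW) (x : VE W b)
    (i : ι) : coordV W b (φ.1 x) i = ∑ᶠ j, matrixOf W b hW φ i j * coordV W b x j := by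
  obtain ⟨y, hy, h⟩ := exists_row hb hW φ i
  rw [h, pairing_apply, hy]
  exact finsum_congr fun j => mul_comm _ _

lemma matrixOf_injective (hb : W.Compatible b) (hW : W.Nontriv) :
    Function.Injective (matrixOf W b hW) := by
  intro φ ψ h
  apply Subtype.ext
  ext1 x
  apply coordV_injective
  ext i
  rw [coordV_map hb, coordV_map hb, h]

lemma matrixOf_mul (hb : W.Compatible b) (hW : W.Nontriv) (φ ψ : flagMackey W b hW) :
    matrixOf W b hW (φ * ψ) = mulMat (matrixOf W b hW φ) (matrixOf W b hW ψ) := by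
  ext i k
  exact coordV_map hb hW φ (ψ.1 (incl W b (b k))) i

open Classical in
lemma idMat_apply (i j : ι) : idMat ι i j = if i = j then 1 else 0 := by
  rw [idMat, Matrix.one_apply]

lemma matrixOf_one (hW : W.Nontriv) : matrixOf W b hW 1 = idMat ι := by
  classical
  ext i j
  rw [matrixOf_apply]
  change coordV W b (incl W b (b j)) i = _
  rw [coordV_incl_basis, idMat_apply]
  simp only [eq_comm]

lemma matrixOf_mul_support_finite (hb : W.Compatible b) (hW : W.Nontriv)
    (φ ψ : flagMackey W b hW) (i k : ι) :
    (Function.support fun j => matrixOf W b hW φ i j * matrixOf W b hW ψ j k).Finite := by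
  obtain ⟨y, hy, -⟩ := exists_row hb hW φ i
  refine (pairing_finite W b hW (ψ.1 (incl W b (b k))) y).subset ?_
  intro j hj
  rw [← hy] at hj
  rwa [Function.mem_support, mul_comm] at hj

/-- The rows and columns of the matrix of an element of the Mackey group satisfy the second
condition in the definition of an aligned matrix; only the finiteness below the block diagonal
is at stake. -/
lemma aligned_matrixOf (hb : W.Compatible b) (hW : W.Nontriv) (φ : flagMackey W b hW)
    (h : {q : ι × ι | IsBelow W b q.1 q.2 ∧ matrixOf W b hW φ q.1 q.2 ≠ 0}.Finite) :
    Aligned W b (matrixOf W b hW φ) := by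
  refine ⟨h, fun a ha => ⟨fun i _ => ?_, fun j _ => ?_⟩⟩
  · obtain ⟨y, hy, -⟩ := exists_row hb hW φ i
    rw [← hy]
    exact coordD_finite y ha
  · exact coordV_finite _ ha

/-! ### Operators defined by aligned matrices -/

lemma Aligned.row_finite {M : Matrix ι ι ℂ} (hM : Aligned W b M) {a : A}
    (ha : IsProperSub (W.space a)) (i : ι) : {j | b j ∈ W.space a ∧ M i j ≠ 0}.Finite := by
  by_cases hi : b i ∈ W.space a
  · exact (hM.2 a ha).1 i hi
  · refine (hM.1.image Prod.snd).subset ?_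
    rintro j ⟨hj, hne⟩
    exact ⟨(i, j), ⟨⟨a, hj, hi⟩, hne⟩, rfl⟩

lemma Aligned.col_finite {M : Matrix ι ι ℂ} (hM : Aligned W b M) {a : A}
    (ha : IsProperSub (W.space a)) (j : ι) : {i | b i ∉ W.space a ∧ M i j ≠ 0}.Finite := by
  by_cases hj : b j ∈ W.space a
  · refine (hM.1.image Prod.fst).subset ?_
    rintro i ⟨hi, hne⟩
    exact ⟨(i, j), ⟨⟨a, hj, hi⟩, hne⟩, rfl⟩
  · exact (hM.2 a ha).2 j hj

/-- For an aligned matrix `M`, `x ∈ V^W_E` and `y ∈ V^W_{*E}`, the double sum `∑ y_i M_ij x_j` has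
finitely many nonzero terms. -/
lemma Aligned.finite_double {M : Matrix ι ι ℂ} (hM : Aligned W b M) (hW : W.Nontriv)
    (x : VE W b) (y : VEdual W b) :
    {q : ι × ι | coordD W b y q.1 * M q.1 q.2 * coordV W b x q.2 ≠ 0}.Finite := by
  obtain ⟨a, ha⟩ := hW
  have hy := coordD_finite y ha
  have hx := coordV_finite x ha
  -- the entries whose row index lies in the flag member
  have h1 : (⋃ i ∈ {i | b i ∈ W.space a ∧ coordD W b y i ≠ 0},
      (fun j => (i, j)) '' ({j | b j ∈ W.space a ∧ M i j ≠ 0} ∪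
        {j | b j ∉ W.space a ∧ coordV W b x j ≠ 0})).Finite :=
    hy.biUnion fun i _ => ((hM.row_finite ha i).union hx).image _
  -- the entries whose column index lies outside the flag member
  have h2 : (⋃ j ∈ {j | b j ∉ W.space a ∧ coordV W b x j ≠ 0},
      (fun i => (i, j)) '' {i | b i ∉ W.space a ∧ M i j ≠ 0}).Finite :=
    hx.biUnion fun j _ => (hM.col_finite ha j).image _
  refine ((h1.union h2).union hM.1).subset ?_
  rintro ⟨i, j⟩ hne
  simp only [Set.mem_ofPred_eq] at hne
  have hxj := right_ne_zero_of_mul hne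
  have hyi := left_ne_zero_of_mul (left_ne_zero_of_mul hne)
  have hm := right_ne_zero_of_mul (left_ne_zero_of_mul hne)
  simp only [Set.mem_union, Set.mem_iUnion, Set.mem_image, Set.mem_ofPred_eq, Prod.mk.injEq]
  by_cases hi : b i ∈ W.space a
  · refine Or.inl (Or.inl ⟨i, ⟨hi, hyi⟩, j, ?_, rfl, rfl⟩)
    by_cases hj : b j ∈ W.space a
    · exact Or.inl ⟨hj, hm⟩
    · exact Or.inr ⟨hj, hxj⟩
  · by_cases hj : b j ∈ W.space a
    · exact Or.inr ⟨⟨a, hj, hi⟩, hm⟩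
    · exact Or.inl (Or.inr ⟨j, ⟨hj, hxj⟩, i, ⟨hi, hm⟩, rfl, rfl⟩)

lemma Aligned.exists_row (hb : W.Compatible b) {M : Matrix ι ι ℂ} (hM : Aligned W b M) (i : ι) :
    ∃ y : VEdual W b, coordD W b y = M i :=
  exists_coordD_eq hb _ fun _ ha => hM.row_finite ha i

lemma Aligned.sum_support_finite (hb : W.Compatible b) (hW : W.Nontriv) {M : Matrix ι ι ℂ}
    (hM : Aligned W b M) (x : VE W b) (i : ι) :
    (Function.support fun j => M i j * coordV W b x j).Finite := by
  obtain ⟨y, hy⟩ := hM.exists_row hb i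
  refine (pairing_finite W b hW x y).subset ?_
  intro j hj
  rw [← hy] at hj
  rwa [Function.mem_support, mul_comm] at hj

lemma exists_ne_zero_of_finsum_ne {f : ι → ℂ} (h : ∑ᶠ i, f i ≠ 0) : ∃ i, f i ≠ 0 := by
  by_contra hc
  push Not at hc
  exact h (by simp [hc])

lemma Aligned.exists_mulVec {M : Matrix ι ι ℂ} (hM : Aligned W b M)
    (x : VE W b) : ∃ z : VE W b, coordV W b z = fun i => ∑ᶠ j, M i j * coordV W b x j := by
  refine exists_coordV_eq _ fun a ha => ?_
  have hx := coordV_finite x ha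
  have h2 : (⋃ j ∈ {j | b j ∉ W.space a ∧ coordV W b x j ≠ 0},
      {i | b i ∉ W.space a ∧ M i j ≠ 0}).Finite :=
    hx.biUnion fun j _ => hM.col_finite ha j
  refine (h2.union (hM.1.image Prod.fst)).subset ?_
  rintro i ⟨hi, hne⟩
  obtain ⟨j, hj⟩ := exists_ne_zero_of_finsum_ne hne
  have hm := left_ne_zero_of_mul hj
  by_cases hja : b j ∈ W.space a
  · exact Or.inr ⟨(i, j), ⟨⟨a, hja, hi⟩, hm⟩, rfl⟩
  · left
    simp only [Set.mem_iUnion, Set.mem_ofPred_eq]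
    exact ⟨j, ⟨hja, right_ne_zero_of_mul hj⟩, hi, hm⟩

lemma Aligned.exists_vecMul (hb : W.Compatible b) {M : Matrix ι ι ℂ} (hM : Aligned W b M)
    (y : VEdual W b) :
    ∃ z : VEdual W b, coordD W b z = fun j => ∑ᶠ i, coordD W b y i * M i j := by
  refine exists_coordD_eq hb _ fun a ha => ?_
  have hy := coordD_finite y ha
  have h2 : (⋃ i ∈ {i | b i ∈ W.space a ∧ coordD W b y i ≠ 0},
      {j | b j ∈ W.space a ∧ M i j ≠ 0}).Finite :=
    hy.biUnion fun i _ => hM.row_finite ha i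
  refine (h2.union (hM.1.image Prod.snd)).subset ?_
  rintro j ⟨hj, hne⟩
  obtain ⟨i, hi⟩ := exists_ne_zero_of_finsum_ne hne
  have hm := right_ne_zero_of_mul hi
  by_cases hia : b i ∈ W.space a
  · left
    simp only [Set.mem_iUnion, Set.mem_ofPred_eq]
    exact ⟨i, ⟨hia, left_ne_zero_of_mul hi⟩, hj, hm⟩
  · exact Or.inr ⟨(i, j), ⟨⟨a, hj, hia⟩, hm⟩, rfl⟩

/-- The operator `x ↦ M x` on `V^W_E` defined by an aligned matrix. -/
def Aligned.op (hb : W.Compatible b) (hW : W.Nontriv) {M : Matrix ι ι ℂ} (hM : Aligned W b M) :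
    VE W b →ₗ[ℂ] VE W b where
  toFun x := (hM.exists_mulVec x).choose
  map_add' x x' := by
    apply coordV_injective
    ext i
    have h : ∀ z, coordV W b (hM.exists_mulVec z).choose i = ∑ᶠ j, M i j * coordV W b z j :=
      fun z => congrFun (hM.exists_mulVec z).choose_spec i
    have e : ∀ u v, coordV W b (u + v) i = coordV W b u i + coordV W b v i :=
      fun u v => congrFun (map_add _ u v) i
    rw [e, h, h, h,
      ← finsum_add_distrib (hM.sum_support_finite hb hW x i) (hM.sum_support_finite hb hW x' i)]
    exact finsum_congr fun j => by rw [map_add, Pi.add_apply, mul_add]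
  map_smul' c x := by
    apply coordV_injective
    ext i
    have h : ∀ z, coordV W b (hM.exists_mulVec z).choose i = ∑ᶠ j, M i j * coordV W b z j :=
      fun z => congrFun (hM.exists_mulVec z).choose_spec i
    have e : ∀ u, coordV W b (c • u) i = c * coordV W b u i :=
      fun u => congrFun (map_smul _ c u) i
    rw [RingHom.id_apply, e, h, h, mul_finsum' _ _ (hM.sum_support_finite hb hW x i)]
    exact finsum_congr fun j => by rw [map_smul, Pi.smul_apply, smul_eq_mul, mul_left_comm]

lemma Aligned.coordV_op (hb : W.Compatible b) (hW : W.Nontriv) {M : Matrix ι ι ℂ}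
    (hM : Aligned W b M) (x : VE W b) (i : ι) :
    coordV W b (hM.op hb hW x) i = ∑ᶠ j, M i j * coordV W b x j :=
  congrFun (hM.exists_mulVec x).choose_spec i

/-- The operator of an aligned matrix has an adjoint on `V^W_{*E}`, given by `y ↦ y M`. -/
lemma Aligned.pairing_op (hb : W.Compatible b) (hW : W.Nontriv) {M : Matrix ι ι ℂ}
    (hM : Aligned W b M) (x : VE W b) {y z : VEdual W b}
    (hz : coordD W b z = fun j => ∑ᶠ i, coordD W b y i * M i j) :
    pairing W b hW (hM.op hb hW x) y = pairing W b hW x z := by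
  classical
  have hfin := hM.finite_double hW x y
  set s := hfin.toFinset.image Prod.fst with hs
  set t := hfin.toFinset.image Prod.snd with ht
  have hs' : ∀ i j, coordD W b y i * M i j * coordV W b x j ≠ 0 → i ∈ s := fun i j h =>
    Finset.mem_image.2 ⟨(i, j), hfin.mem_toFinset.2 h, rfl⟩
  have ht' : ∀ i j, coordD W b y i * M i j * coordV W b x j ≠ 0 → j ∈ t := fun i j h =>
    Finset.mem_image.2 ⟨(i, j), hfin.mem_toFinset.2 h, rfl⟩
  have hrow : ∀ i, coordV W b (hM.op hb hW x) i * coordD W b y i =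
      ∑ᶠ j, coordD W b y i * M i j * coordV W b x j := by
    intro i
    rw [hM.coordV_op, mul_comm, mul_finsum' _ _ (hM.sum_support_finite hb hW x i)]
    exact finsum_congr fun j => (mul_assoc _ _ _).symm
  have hcol : ∀ j, coordV W b x j * coordD W b z j =
      ∑ᶠ i, coordD W b y i * M i j * coordV W b x j := by
    intro j
    rw [hz]
    by_cases hx : coordV W b x j = 0
    · simp [hx]
    · have hf : (Function.support fun i => coordD W b y i * M i j).Finite := by
        refine (hfin.image Prod.fst).subset fun i hi => ⟨(i, j), mul_ne_zero hi hx, rfl⟩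
      rw [mul_comm, finsum_mul' _ _ hf]
  rw [pairing_apply, pairing_apply, finsum_congr hrow, finsum_congr hcol]
  have e1 : ∀ i, ∑ᶠ j, coordD W b y i * M i j * coordV W b x j =
      ∑ j ∈ t, coordD W b y i * M i j * coordV W b x j := fun i =>
    finsum_eq_sum_of_support_subset _ fun j hj => ht' i j hj
  have e2 : ∀ j, ∑ᶠ i, coordD W b y i * M i j * coordV W b x j =
      ∑ i ∈ s, coordD W b y i * M i j * coordV W b x j := fun j =>
    finsum_eq_sum_of_support_subset _ fun i hi => hs' i j hi
  rw [finsum_congr e1, finsum_congr e2, finsum_eq_sum_of_support_subset _ (s := s),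
    finsum_eq_sum_of_support_subset _ (s := t), Finset.sum_comm]
  · intro j hj
    obtain ⟨i, -, hi⟩ := Finset.exists_ne_zero_of_sum_ne_zero hj
    exact ht' i j hi
  · intro i hi
    obtain ⟨j, -, hj⟩ := Finset.exists_ne_zero_of_sum_ne_zero hi
    exact hs' i j hj

lemma Aligned.op_op_of_mulMat_eq (hb : W.Compatible b) (hW : W.Nontriv) {M N : Matrix ι ι ℂ}
    (hM : Aligned W b M) (hN : Aligned W b N) (h : mulMat M N = idMat ι) (x : VE W b) :
    hM.op hb hW (hN.op hb hW x) = x := by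
  classical
  apply coordV_injective
  ext i
  obtain ⟨y, hy⟩ := hM.exists_row hb i
  obtain ⟨z, hz⟩ := hN.exists_vecMul hb y
  have h1 : coordV W b (hM.op hb hW (hN.op hb hW x)) i =
      pairing W b hW (hN.op hb hW x) y := by
    rw [hM.coordV_op, pairing_apply, hy]
    exact finsum_congr fun j => mul_comm _ _
  have hz1 : ∀ k, coordD W b z k = if i = k then 1 else 0 := by
    intro k
    rw [hz, hy, ← idMat_apply, ← h]
    rfl
  rw [h1, hN.pairing_op hb hW x hz,
    pairing_single hW x (i := i) rfl (by rw [hz1, if_pos rfl])]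
  intro j hj
  rw [hz1, if_neg (Ne.symm hj)]

/-- An aligned matrix with an aligned inverse is the matrix of an element of the Mackey group. -/
lemma Aligned.exists_matrixOf_eq (hb : W.Compatible b) (hW : W.Nontriv) {M N : Matrix ι ι ℂ}
    (hM : Aligned W b M) (hN : Aligned W b N) (hMN : mulMat M N = idMat ι)
    (hNM : mulMat N M = idMat ι) :
    ∃ φ : flagMackey W b hW, matrixOf W b hW φ = M ∧ matrixOf W b hW φ⁻¹ = N := by
  classical
  have hmat : ∀ {P : Matrix ι ι ℂ} (hP : Aligned W b P) (i j : ι),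
      coordV W b (hP.op hb hW (incl W b (b j))) i = P i j := by
    intro P hP i j
    rw [hP.coordV_op, finsum_eq_single _ j, coordV_incl_basis, if_pos rfl, mul_one]
    intro k hk
    rw [coordV_incl_basis, if_neg (Ne.symm hk), mul_zero]
  let φ : VE W b ≃ₗ[ℂ] VE W b := LinearEquiv.ofLinearMap (hM.op hb hW) (hN.op hb hW)
    (LinearMap.ext (hM.op_op_of_mulMat_eq hb hW hN hMN))
    (LinearMap.ext (hN.op_op_of_mulMat_eq hb hW hM hNM))
  have hφ : φ ∈ flagMackey W b hW := by
    apply le_antisymm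
    · rintro _ ⟨_, ⟨y, rfl⟩, rfl⟩
      obtain ⟨z, hz⟩ := hM.exists_vecMul hb y
      refine ⟨z, LinearMap.ext fun x => ?_⟩
      exact (hM.pairing_op hb hW x hz).symm
    · rintro _ ⟨y, rfl⟩
      obtain ⟨z, hz⟩ := hN.exists_vecMul hb y
      refine ⟨(pairing W b hW).flip z, ⟨z, rfl⟩, LinearMap.ext fun x => ?_⟩
      change pairing W b hW (hM.op hb hW x) z = pairing W b hW x y
      rw [← hN.pairing_op hb hW _ hz, hN.op_op_of_mulMat_eq hb hW hM hNM]
  exact ⟨⟨φ, hφ⟩, Matrix.ext fun i j => hmat hM i j, Matrix.ext fun i j => hmat hN i j⟩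

/-! ### Finitary operators -/

/-- `κ` lives on the finite set `S`: it fixes the basis vectors outside `S` and preserves the span
of those in `S`. -/
def SupportedOn (b : Basis ι ℂ V) (S : Finset ι) (κ : V ≃ₗ[ℂ] V) : Prop :=
  (∀ j ∉ S, κ (b j) = b j) ∧ ∀ j ∈ S, ∀ i ∉ S, b.repr (κ (b j)) i = 0

lemma SupportedOn.mono {S S' : Finset ι} {κ : V ≃ₗ[ℂ] V} (h : SupportedOn b S κ) (hS : S ⊆ S') :
    SupportedOn b S' κ := by
  classical
  refine ⟨fun j hj => h.1 j fun hj' => hj (hS hj'), fun j hj i hi => ?_⟩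
  by_cases hjS : j ∈ S
  · exact h.2 j hjS i fun hi' => hi (hS hi')
  · rw [h.1 j hjS, Basis.repr_self, Finsupp.single_eq_of_ne]
    rintro rfl
    exact hi hj

lemma exists_supportedOn_aux {κ : V ≃ₗ[ℂ] V} (hκ : κ ∈ finitaryGL b) :
    ∃ S : Finset ι, SupportedOn b S κ := by
  classical
  have hfin : {i | κ (b i) ≠ b i}.Finite := hκ
  set D := hfin.toFinset with hD
  have hD' : ∀ j ∉ D, κ (b j) = b j := fun j hj => by
    by_contra h
    exact hj (hfin.mem_toFinset.2 h)
  refine ⟨D ∪ D.biUnion fun j => (b.repr (κ (b j))).support, fun j hj => ?_, fun j hj i hi => ?_⟩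
  · exact hD' j fun h => hj (Finset.mem_union_left _ h)
  · by_cases hjD : j ∈ D
    · by_contra hne
      exact hi (Finset.mem_union_right _
        (Finset.mem_biUnion.2 ⟨j, hjD, Finsupp.mem_support_iff.2 hne⟩))
    · rw [hD' j hjD, Basis.repr_self, Finsupp.single_eq_of_ne]
      rintro rfl
      exact hi hj

lemma exists_supportedOn {κ : V ≃ₗ[ℂ] V} (hκ : κ ∈ finitaryGL b) :
    ∃ S : Finset ι, SupportedOn b S κ ∧ SupportedOn b S κ⁻¹ := by
  classical
  obtain ⟨S, hS⟩ := exists_supportedOn_aux hκ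
  obtain ⟨S', hS'⟩ := exists_supportedOn_aux (inv_mem hκ)
  exact ⟨S ∪ S', hS.mono Finset.subset_union_left, hS'.mono Finset.subset_union_right⟩

open Classical in
lemma SupportedOn.repr_apply {S : Finset ι} {κ : V ≃ₗ[ℂ] V} (h : SupportedOn b S κ) {i : ι}
    (hi : i ∉ S) (j : ι) : b.repr (κ (b j)) i = if j = i then 1 else 0 := by
  by_cases hj : j ∈ S
  · rw [h.2 j hj i hi, if_neg]
    rintro rfl
    exact hi hj
  · rw [h.1 j hj, Basis.repr_self, Finsupp.single_apply]

/-- The matrix of an operator on `V`. -/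
def matV (b : Basis ι ℂ V) (κ : V ≃ₗ[ℂ] V) : Matrix ι ι ℂ :=
  Matrix.of fun i j => b.repr (κ (b j)) i

lemma SupportedOn.aligned_matV {S : Finset ι} {κ : V ≃ₗ[ℂ] V} (h : SupportedOn b S κ) :
    Aligned W b (matV b κ) := by
  classical
  have key : ∀ i j, matV b κ i j ≠ 0 → i = j ∨ i ∈ S ∧ j ∈ S := by
    intro i j hne
    by_contra hc
    push Not at hc
    apply hne
    change b.repr (κ (b j)) i = 0
    by_cases hi : i ∈ S
    · rw [h.1 j (hc.2 hi), Basis.repr_self, Finsupp.single_eq_of_ne hc.1]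
    · rw [h.repr_apply hi, if_neg (Ne.symm hc.1)]
  refine ⟨(S ×ˢ S).finite_toSet.subset ?_, fun a _ => ⟨fun i _ => ?_, fun j _ => ?_⟩⟩
  · rintro ⟨i, j⟩ ⟨⟨a, hj, hi⟩, hne⟩
    rcases key i j hne with heq | hS
    · exact absurd (heq ▸ hj) hi
    · exact Finset.mem_coe.2 (Finset.mem_product.2 hS)
  · refine (insert i S).finite_toSet.subset ?_
    rintro j ⟨-, hne⟩
    rcases key i j hne with heq | hS
    · simp [heq]
    · simp [hS.2]
  · refine (insert j S).finite_toSet.subset ?_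
    rintro i ⟨-, hne⟩
    rcases key i j hne with heq | hS
    · simp [heq]
    · simp [hS.1]

lemma mulMat_matV (κ κ' : V ≃ₗ[ℂ] V) : mulMat (matV b κ) (matV b κ') = matV b (κ * κ') := by
  ext i k
  change ∑ᶠ j, b.repr (κ (b j)) i * b.repr (κ' (b k)) j = b.repr (κ (κ' (b k))) i
  conv_rhs => rw [← b.linearCombination_repr (κ' (b k)), Finsupp.linearCombination_apply,
    Finsupp.sum, map_sum, map_sum, Finsupp.finsetSum_apply]
  rw [finsum_eq_sum_of_support_subset (s := (b.repr (κ' (b k))).support)]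
  · refine Finset.sum_congr rfl fun j _ => ?_
    rw [map_smul, map_smul, Finsupp.smul_apply, smul_eq_mul, mul_comm]
  · intro j hj
    exact Finsupp.mem_support_iff.2 (right_ne_zero_of_mul hj)

lemma matV_one : matV b 1 = idMat ι := by
  classical
  ext i j
  change b.repr (b j) i = _
  rw [Basis.repr_self, Finsupp.single_apply, idMat_apply]
  simp only [eq_comm]

lemma extends_iff (hW : W.Nontriv) (φ : flagMackey W b hW) (κ : V ≃ₗ[ℂ] V) :
    Extends W b hW φ κ ↔ matrixOf W b hW φ = matV b κ := by
  constructor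
  · intro h
    ext i j
    rw [matrixOf_apply, h, coordV_incl]
    rfl
  · intro h v
    have : φ.1.toLinearMap ∘ₗ incl W b = incl W b ∘ₗ κ.toLinearMap := by
      refine b.ext fun j => ?_
      apply coordV_injective
      ext i
      exact congrFun (congrFun h i) j
    exact congrArg (fun f => f v) this

lemma existsUnique_extends (hb : W.Compatible b) (hW : W.Nontriv) {κ : V ≃ₗ[ℂ] V}
    (hκ : κ ∈ finitaryGL b) : ∃! φ : flagMackey W b hW, Extends W b hW φ κ := by
  obtain ⟨S, hS, hS'⟩ := exists_supportedOn hκ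
  obtain ⟨φ, hφ, -⟩ := Aligned.exists_matrixOf_eq hb hW hS.aligned_matV hS'.aligned_matV
    (by rw [mulMat_matV, mul_inv_cancel, matV_one]) (by rw [mulMat_matV, inv_mul_cancel, matV_one])
  refine ⟨φ, (extends_iff hW φ κ).2 hφ, fun ψ hψ => ?_⟩
  apply matrixOf_injective hb hW
  rw [hφ]
  exact (extends_iff hW ψ κ).1 hψ

lemma Extends.inv {hW : W.Nontriv} {φ : flagMackey W b hW} {κ : V ≃ₗ[ℂ] V}
    (h : Extends W b hW φ κ) : Extends W b hW φ⁻¹ κ⁻¹ := by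
  intro v
  have := h (κ⁻¹ v)
  have hv : κ (κ⁻¹ v) = v := κ.apply_symm_apply v
  rw [hv] at this
  rw [← this]
  exact φ.1.symm_apply_apply _

/-- The extension of a finitary operator supported on `S` does not change the coordinates
outside `S`. -/
lemma Extends.coordV_apply (hb : W.Compatible b) {hW : W.Nontriv} {φ : flagMackey W b hW}
    {κ : V ≃ₗ[ℂ] V} (h : Extends W b hW φ κ) {S : Finset ι} (hS : SupportedOn b S κ)
    (x : VE W b) {i : ι} (hi : i ∉ S) : coordV W b (φ.1 x) i = coordV W b x i := by
  classical
  rw [coordV_map hb, (extends_iff hW φ κ).1 h]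
  have : ∀ j, matV b κ i j = if j = i then 1 else 0 := fun j => hS.repr_apply hi j
  rw [finsum_eq_single _ i, this, if_pos rfl, one_mul]
  intro j hj
  rw [this, if_neg hj, zero_mul]

/-- The extension of a finitary operator supported on `S` fixes the elements that vanish on `S`. -/
lemma Extends.apply_eq_self (hb : W.Compatible b) {hW : W.Nontriv} {φ : flagMackey W b hW}
    {κ : V ≃ₗ[ℂ] V} (h : Extends W b hW φ κ) {S : Finset ι} (hS : SupportedOn b S κ)
    {x : VE W b} (hx : ∀ i ∈ S, coordV W b x i = 0) : φ.1 x = x := by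
  classical
  apply coordV_injective
  ext i
  by_cases hi : i ∈ S
  · rw [coordV_map hb, (extends_iff hW φ κ).1 h, hx i hi]
    have : ∀ j, matV b κ i j * coordV W b x j = 0 := by
      intro j
      by_cases hj : j ∈ S
      · rw [hx j hj, mul_zero]
      · change b.repr (κ (b j)) i * _ = 0
        rw [hS.1 j hj, Basis.repr_self, Finsupp.single_eq_of_ne, zero_mul]
        rintro rfl
        exact hj hi
    simp [this]
  · exact h.coordV_apply hb hS x hi

end Operators

/-! ### Finite-dimensional flags of equal dimensions -/

section FiniteFlags

variable {K : Type*} [Field K] {X Y : Type*} [AddCommGroup X] [Module K X] [AddCommGroup Y]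
  [Module K Y]

lemma exists_equiv_of_isCompl {p p' : Submodule K X} {q q' : Submodule K Y} (hp : IsCompl p p')
    (hq : IsCompl q q') (e : p ≃ₗ[K] q) (e' : p' ≃ₗ[K] q') :
    ∃ E : X ≃ₗ[K] Y, (∀ x : p, E x = e x) ∧ ∀ x : p', E x = e' x := by
  refine ⟨(Submodule.prodEquivOfIsCompl p p' hp).symm ≪≫ₗ (e.prodCongr e') ≪≫ₗ
    Submodule.prodEquivOfIsCompl q q' hq, fun x => ?_, fun x => ?_⟩
  · simp
  · simp

lemma exists_equiv_extends [FiniteDimensional K X] [FiniteDimensional K Y]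
    (h : finrank K X = finrank K Y) {p : Submodule K X} {q : Submodule K Y} (e : p ≃ₗ[K] q) :
    ∃ E : X ≃ₗ[K] Y, ∀ x : p, E x = e x := by
  obtain ⟨p', hp⟩ := p.exists_isCompl
  obtain ⟨q', hq⟩ := q.exists_isCompl
  have h1 := Submodule.finrank_add_eq_of_isCompl hp
  have h2 := Submodule.finrank_add_eq_of_isCompl hq
  have h3 := e.finrank_eq
  obtain ⟨E, hE, -⟩ := exists_equiv_of_isCompl hp hq e
    (LinearEquiv.ofFinrankEq p' q' (by omega))
  exact ⟨E, hE⟩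

lemma finrank_comap_subtype_of_le {p q : Submodule K X} (h : q ≤ p) :
    finrank K (q.comap p.subtype) = finrank K q :=
  (Submodule.comapSubtypeEquivOfLe h).finrank_eq

lemma finrank_comap_subtype_of_ge {p q : Submodule K X} (h : p ≤ q) :
    finrank K (q.comap p.subtype) = finrank K p := by
  rw [Submodule.comap_subtype_eq_top.2 h, finrank_top]

/-- Two chains of subspaces of finite-dimensional spaces with the same dimensions are related by an
isomorphism. The largest proper member of the chain is treated by induction, and the isomorphism
found there is extended to the whole space. -/
lemma exists_equiv_map_flag {A : Type*} [LinearOrder A] (n : ℕ) :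
    ∀ {X Y : Type*} [AddCommGroup X] [Module K X] [AddCommGroup Y] [Module K Y]
      [FiniteDimensional K X] [FiniteDimensional K Y] (_ : finrank K X = n)
      (_ : finrank K Y = n) (f : A → Submodule K X) (g : A → Submodule K Y)
      (_ : Monotone f) (_ : Monotone g) (_ : ∀ a, finrank K (f a) = finrank K (g a)),
      ∃ e : X ≃ₗ[K] Y, ∀ a, (f a).map e.toLinearMap = g a := by
  induction n using Nat.strong_induction_on with
  | _ n ih =>
  intro X Y _ _ _ _ _ _ hX hY f g hf hg hfg
  have htop : ∀ a, f a = ⊤ → g a = ⊤ := by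
    intro a ha
    apply Submodule.eq_top_of_finrank_eq
    rw [← hfg, ha, finrank_top, hX, hY]
  by_cases hall : ∀ a, f a = ⊤
  · refine ⟨LinearEquiv.ofFinrankEq X Y (hX.trans hY.symm), fun a => ?_⟩
    rw [hall a, htop a (hall a), Submodule.map_top, LinearEquiv.range]
  · push Not at hall
    obtain ⟨a₀, ha₀⟩ := hall
    have hbdd : BddAbove {m | ∃ a, f a ≠ ⊤ ∧ finrank K (f a) = m} := by
      refine ⟨n, ?_⟩
      rintro _ ⟨a, -, rfl⟩
      exact hX ▸ Submodule.finrank_le _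
    have hne : {m | ∃ a, f a ≠ ⊤ ∧ finrank K (f a) = m}.Nonempty := ⟨_, a₀, ha₀, rfl⟩
    obtain ⟨a, ha, hamax⟩ := Nat.sSup_mem hne hbdd
    have hmax : ∀ c, f c ≠ ⊤ → finrank K (f c) ≤ finrank K (f a) := fun c hc => by
      rw [hamax]
      exact le_csSup hbdd ⟨c, hc, rfl⟩
    have hlt : finrank K (f a) < n := hX ▸ Submodule.finrank_lt ha
    obtain ⟨e, he⟩ := ih _ hlt rfl (hfg a).symm
      (fun c => (f c).comap (f a).subtype) (fun c => (g c).comap (g a).subtype)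
      (fun c d h => Submodule.comap_mono (hf h)) (fun c d h => Submodule.comap_mono (hg h))
      (fun c => by
        rcases le_total c a with h | h
        · rw [finrank_comap_subtype_of_le (hf h), finrank_comap_subtype_of_le (hg h), hfg]
        · rw [finrank_comap_subtype_of_ge (hf h), finrank_comap_subtype_of_ge (hg h), hfg])
    obtain ⟨E, hE⟩ := exists_equiv_extends (hX.trans hY.symm) e
    refine ⟨E, fun c => ?_⟩
    by_cases hc : f c = ⊤
    · rw [hc, htop c hc, Submodule.map_top, LinearEquiv.range]
    · have hle : f c ≤ f a := by
        rcases le_total c a with h | h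
        · exact hf h
        · exact (Submodule.eq_of_le_of_finrank_le (hf h) (hmax c hc)).ge
      refine Submodule.eq_of_le_of_finrank_eq ?_ ?_
      · rintro _ ⟨x, hx, rfl⟩
        have : e ⟨x, hle hx⟩ ∈ (g c).comap (g a).subtype := by
          rw [← he c]
          exact ⟨⟨x, hle hx⟩, hx, rfl⟩
        have h2 := hE ⟨x, hle hx⟩
        change E x = _ at h2
        change E x ∈ g c
        rw [h2]
        exact this
      · rw [LinearEquiv.finrank_map_eq, hfg]

lemma finrank_map_add_finrank_inf_ker (p : Submodule K X) [FiniteDimensional K p]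
    (f : X →ₗ[K] Y) :
    finrank K (p.map f) + finrank K (p ⊓ LinearMap.ker f : Submodule K X) = finrank K p := by
  have h := LinearMap.finrank_range_add_finrank_ker (f.domRestrict p)
  rw [LinearMap.range_domRestrict, LinearMap.ker_domRestrict] at h
  rw [← h, ← finrank_comap_subtype_of_le (inf_le_left : p ⊓ LinearMap.ker f ≤ p),
    Submodule.comap_inf, Submodule.comap_subtype_self, top_inf_eq]

end FiniteFlags

/-! ### Stabilizers of the flag -/

section Stabilizer

variable {A ι V : Type*} [LinearOrder A] [AddCommGroup V] [Module ℂ V]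
  (W : GeneralizedFlag A V) (b : Basis ι ℂ V)

/-- The elements of `V^W_E` whose coordinates outside `W_a` vanish; this is the closure
`W_a^{⊥⊥}` of `W_a`. -/
def closed (a : A) : Submodule ℂ (VE W b) where
  carrier := {x | ∀ i, b i ∉ W.space a → coordV W b x i = 0}
  zero_mem' := fun i _ => by rw [map_zero]; rfl
  add_mem' := by
    intro x y hx hy i hi
    rw [map_add, Pi.add_apply, hx i hi, hy i hi, add_zero]
  smul_mem' := by
    intro c x hx i hi
    rw [map_smul, Pi.smul_apply, hx i hi, smul_zero]

variable {W b}

lemma mem_closed {a : A} {x : VE W b} :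
    x ∈ closed W b a ↔ ∀ i, b i ∉ W.space a → coordV W b x i = 0 := Iff.rfl

lemma incl_mem_closed (hb : W.Compatible b) {a : A} {v : V} :
    incl W b v ∈ closed W b a ↔ v ∈ W.space a :=
  (mem_space_iff_repr hb a v).symm

lemma perpLeft_perpRight (hb : W.Compatible b) (hW : W.Nontriv) (a : A) :
    perpLeft (pairing W b hW) (perpRight (pairing W b hW) ((W.space a).map (incl W b))) =
      closed W b a := by
  classical
  have hR : ∀ y, y ∈ perpRight (pairing W b hW) ((W.space a).map (incl W b)) ↔
      ∀ j, b j ∈ W.space a → coordD W b y j = 0 := by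
    intro y
    rw [perpRight, Submodule.mem_comap, Submodule.mem_dualAnnihilator]
    constructor
    · intro h j hj
      rw [← pairing_incl_basis hW]
      exact h _ (Submodule.mem_map_of_mem hj)
    · rintro h _ ⟨v, hv, rfl⟩
      change pairing W b hW (incl W b v) y = 0
      rw [pairing_apply]
      refine finsum_eq_zero_of_forall_eq_zero fun j => ?_
      by_cases hj : b j ∈ W.space a
      · rw [h j hj, mul_zero]
      · rw [coordV_incl, (mem_space_iff_repr hb a v).1 hv j hj, zero_mul]
  ext x
  rw [perpLeft, Submodule.mem_comap, Submodule.mem_dualAnnihilator, mem_closed]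
  constructor
  · intro h i hi
    obtain ⟨y, hy⟩ := exists_coordD_eq_single hb i
    rw [← pairing_single hW x hy (Pi.single_eq_same _ _) fun j hj => Pi.single_eq_of_ne hj _]
    refine h y ((hR y).2 fun j hj => ?_)
    rw [hy, Pi.single_eq_of_ne]
    rintro rfl
    exact hi hj
  · intro h y hy
    rw [pairing_apply]
    refine finsum_eq_zero_of_forall_eq_zero fun j => ?_
    by_cases hj : b j ∈ W.space a
    · rw [(hR y).1 hy j hj, mul_zero]
    · rw [h j hj, zero_mul]

lemma act_space (hb : W.Compatible b) (hW : W.Nontriv) (φ : flagMackey W b hW) (a : A) :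
    act W b hW φ (W.space a) =
      ((closed W b a).map φ.1.toLinearMap).comap (incl W b) := by
  rw [act, perpLeft_perpRight hb hW]

/-- Truncation of a coordinate sequence to a finite set. -/
lemma exists_trunc (b : Basis ι ℂ V) (f : ι → ℂ) (s : Finset ι) :
    ∃ v : V, (∀ i ∈ s, b.repr v i = f i) ∧ ∀ i ∉ s, b.repr v i = 0 := by
  classical
  refine ⟨b.repr.symm (Finsupp.onFinset s (fun i => if i ∈ s then f i else 0) fun i hi => ?_),
    fun i hi => ?_, fun i hi => ?_⟩
  · by_contra h
    exact hi (if_neg h)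
  · rw [LinearEquiv.apply_symm_apply, Finsupp.onFinset_apply, if_pos hi]
  · rw [LinearEquiv.apply_symm_apply, Finsupp.onFinset_apply, if_neg hi]

/-- The stabilizer `St_W` consists of the elements of the Mackey group that preserve the closure
of every member of the flag. -/
lemma mem_stab_iff (hb : W.Compatible b) (hW : W.Nontriv) (φ : flagMackey W b hW) :
    φ ∈ stab W b hW ↔ ∀ a, (closed W b a).map φ.1.toLinearMap = closed W b a := by
  have hcomap : ∀ a, (closed W b a).comap (incl W b) = W.space a := fun a =>
    Submodule.ext fun v => incl_mem_closed hb
  constructor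
  · intro h a
    have ha : ((closed W b a).map φ.1.toLinearMap).comap (incl W b) = W.space a :=
      (act_space hb hW φ a).symm.trans (h a)
    -- `closed a ⊆ φ (closed a)`, because the rows of the inverse see only the basis vectors in `W_a`
    have hle : closed W b a ≤ (closed W b a).map φ.1.toLinearMap := by
      intro x hx
      refine ⟨φ.1.symm x, ?_, φ.1.apply_symm_apply x⟩
      intro i hi
      change coordV W b ((φ⁻¹).1 x) i = 0
      rw [coordV_map hb]
      refine finsum_eq_zero_of_forall_eq_zero fun j => ?_
      by_cases hj : b j ∈ W.space a
      · have : b j ∈ ((closed W b a).map φ.1.toLinearMap).comap (incl W b) := ha ▸ hj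
        obtain ⟨t, ht, htj⟩ := this
        have h2 : matrixOf W b hW φ⁻¹ i j = coordV W b t i := by
          rw [matrixOf_apply, ← htj]
          exact congrArg (fun z => coordV W b z i) (φ.1.symm_apply_apply t)
        rw [h2, ht i hi, zero_mul]
      · rw [hx j hj, mul_zero]
    refine le_antisymm ?_ hle
    by_cases hbot : W.space a = ⊥
    · have : closed W b a = ⊥ := by
        rw [eq_bot_iff]
        intro x hx
        rw [Submodule.mem_bot]
        apply coordV_injective
        ext i
        rw [hx i (by rw [hbot, Submodule.mem_bot]; exact b.ne_zero i), map_zero]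
        rfl
      rw [this, Submodule.map_bot]
    by_cases htop : W.space a = ⊤
    · intro x _ i hi
      exact absurd (htop ▸ Submodule.mem_top) hi
    -- outside `W_a` an element of `φ (closed a)` is finitary, so that this part of it lies in `V`
    intro z hz
    have hfin := coordV_finite z ⟨hbot, htop⟩
    obtain ⟨v, hv, hv'⟩ := exists_trunc b (coordV W b z) hfin.toFinset
    have hzv : z - incl W b v ∈ closed W b a := by
      intro i hi
      rw [map_sub, Pi.sub_apply, coordV_incl, sub_eq_zero]
      by_cases hiz : coordV W b z i = 0
      · rw [hiz, hv' i (by simp [hiz])]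
      · rw [hv i (hfin.mem_toFinset.2 ⟨hi, hiz⟩)]
    have hvW : v ∈ W.space a := by
      rw [← ha, Submodule.mem_comap]
      have := Submodule.sub_mem _ hz (hle hzv)
      rwa [sub_sub_cancel] at this
    rw [← sub_add_cancel z (incl W b v)]
    exact Submodule.add_mem _ hzv ((incl_mem_closed hb).2 hvW)
  · intro h a
    rw [act_space hb hW, h a, hcomap]

lemma inv_mem_stab (hb : W.Compatible b) (hW : W.Nontriv) {φ : flagMackey W b hW}
    (h : φ ∈ stab W b hW) : φ⁻¹ ∈ stab W b hW := by
  rw [mem_stab_iff hb] at h ⊢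
  intro a
  conv_lhs => rw [← h a]
  ext x
  constructor
  · rintro ⟨_, ⟨y, hy, rfl⟩, rfl⟩
    have : (φ⁻¹).1 (φ.1 y) = y := φ.1.symm_apply_apply y
    change (φ⁻¹).1 (φ.1 y) ∈ closed W b a
    rw [this]
    exact hy
  · intro hx
    exact ⟨φ.1 x, ⟨x, hx, rfl⟩, φ.1.symm_apply_apply x⟩

lemma mul_mem_stab (hb : W.Compatible b) (hW : W.Nontriv) {φ ψ : flagMackey W b hW}
    (h : φ ∈ stab W b hW) (h' : ψ ∈ stab W b hW) : φ * ψ ∈ stab W b hW := by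
  rw [mem_stab_iff hb] at h h' ⊢
  intro a
  conv_rhs => rw [← h a, ← h' a]
  exact Submodule.map_comp _ _ _

lemma matrixOf_eq_zero_of_stab (hb : W.Compatible b) (hW : W.Nontriv) {φ : flagMackey W b hW}
    (h : φ ∈ stab W b hW) {i j : ι} (hij : IsBelow W b i j) : matrixOf W b hW φ i j = 0 := by
  rw [mem_stab_iff hb] at h
  obtain ⟨a, hj, hi⟩ := hij
  have : φ.1 (incl W b (b j)) ∈ closed W b a := by
    rw [← h a]
    exact Submodule.mem_map_of_mem ((incl_mem_closed hb).2 hj)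
  exact this i hi

/-! ### Comparison of ranks and dimensions -/

/-- The finite set `S` contains the row and column indices of all nonzero entries below the block
diagonal in the matrices of `φ` and of its inverse. -/
def Adapted (hW : W.Nontriv) (φ : flagMackey W b hW) (S : Finset ι) : Prop :=
  ∀ i j, IsBelow W b i j → (matrixOf W b hW φ i j ≠ 0 ∨ matrixOf W b hW φ⁻¹ i j ≠ 0) →
    i ∈ S ∧ j ∈ S

lemma Adapted.inv {hW : W.Nontriv} {φ : flagMackey W b hW} {S : Finset ι}
    (h : Adapted hW φ S) : Adapted hW φ⁻¹ S := by
  intro i j hij hne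
  rw [inv_inv] at hne
  exact h i j hij hne.symm

lemma exists_adapted {hW : W.Nontriv} {φ : flagMackey W b hW}
    (h : Aligned W b (matrixOf W b hW φ)) (h' : Aligned W b (matrixOf W b hW φ⁻¹)) :
    ∃ S₀ : Finset ι, ∀ S, S₀ ⊆ S → Adapted hW φ S := by
  classical
  have hf := h.1.union h'.1
  refine ⟨hf.toFinset.image Prod.fst ∪ hf.toFinset.image Prod.snd, fun S hS i j hij hne => ?_⟩
  have hmem : (i, j) ∈ hf.toFinset := by
    rw [Set.Finite.mem_toFinset]
    exact hne.imp (fun h => ⟨hij, h⟩) (fun h => ⟨hij, h⟩)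
  exact ⟨hS (Finset.mem_union_left _ (Finset.mem_image_of_mem _ hmem)),
    hS (Finset.mem_union_right _ (Finset.mem_image_of_mem _ hmem))⟩

/-- An element of the closure of `W_a` that vanishes on an adapted set stays in that closure. -/
lemma Adapted.map_mem_closed (hb : W.Compatible b) {hW : W.Nontriv} {φ : flagMackey W b hW}
    {S : Finset ι} (h : Adapted hW φ S) {a : A} {x : VE W b} (hx : x ∈ closed W b a)
    (hxS : ∀ i ∈ S, coordV W b x i = 0) : φ.1 x ∈ closed W b a := by
  intro i hi
  rw [coordV_map hb]
  refine finsum_eq_zero_of_forall_eq_zero fun j => ?_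
  by_cases hj : b j ∈ W.space a
  · by_cases hjS : j ∈ S
    · rw [hxS j hjS, mul_zero]
    · have : matrixOf W b hW φ i j = 0 := by
        by_contra hne
        exact hjS (h i j ⟨a, hj, hi⟩ (Or.inl hne)).2
      rw [this, zero_mul]
  · rw [hx j hj, mul_zero]

/-- Outside an adapted set, the image of an element of the closure of `W_a` has no coordinates
outside `W_a`. -/
lemma Adapted.coordV_map_eq_zero (hb : W.Compatible b) {hW : W.Nontriv} {φ : flagMackey W b hW}
    {S : Finset ι} (h : Adapted hW φ S) {a : A} {x : VE W b} (hx : x ∈ closed W b a) {i : ι}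
    (hiS : i ∉ S) (hi : b i ∉ W.space a) : coordV W b (φ.1 x) i = 0 := by
  rw [coordV_map hb]
  refine finsum_eq_zero_of_forall_eq_zero fun j => ?_
  by_cases hj : b j ∈ W.space a
  · have : matrixOf W b hW φ i j = 0 := by
      by_contra hne
      exact hiS (h i j ⟨a, hj, hi⟩ (Or.inl hne)).1
    rw [this, zero_mul]
  · rw [hx j hj, mul_zero]

/-- The span of the basis vectors with index in `S`. -/
def finSpan (b : Basis ι ℂ V) (S : Finset ι) : Submodule ℂ V :=
  Submodule.span ℂ (b '' (S : Set ι))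

instance (S : Finset ι) : FiniteDimensional ℂ (finSpan b S) :=
  FiniteDimensional.span_of_finite ℂ (S.finite_toSet.image b)

lemma mem_finSpan {S : Finset ι} {v : V} : v ∈ finSpan b S ↔ ∀ i ∉ S, b.repr v i = 0 := by
  rw [finSpan, Basis.mem_span_image]
  constructor
  · intro h i hi
    by_contra hne
    exact hi (h (Finsupp.mem_support_iff.2 hne))
  · intro h i hi
    by_contra hne
    exact Finsupp.mem_support_iff.1 hi (h i hne)

lemma exists_decomp (S : Finset ι) (x : VE W b) :
    ∃ v ∈ finSpan b S, ∃ t : VE W b, x = incl W b v + t ∧ (∀ i ∈ S, coordV W b t i = 0) ∧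
      (∀ i ∈ S, b.repr v i = coordV W b x i) ∧ ∀ i ∉ S, coordV W b t i = coordV W b x i := by
  obtain ⟨v, hv, hv'⟩ := exists_trunc b (coordV W b x) S
  refine ⟨v, mem_finSpan.2 hv', x - incl W b v, by abel, fun i hi => ?_, hv, fun i hi => ?_⟩
  · rw [map_sub, Pi.sub_apply, coordV_incl, hv i hi, sub_self]
  · rw [map_sub, Pi.sub_apply, coordV_incl, hv' i hi, sub_zero]

lemma exists_decomp_closed (hb : W.Compatible b) (S : Finset ι) {a : A} {x : VE W b}
    (hx : x ∈ closed W b a) :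
    ∃ v ∈ finSpan b S ⊓ W.space a, ∃ t ∈ closed W b a, x = incl W b v + t ∧
      ∀ i ∈ S, coordV W b t i = 0 := by
  obtain ⟨v, hv, t, rfl, htS, hvx, htx⟩ := exists_decomp S x
  refine ⟨v, ⟨hv, ?_⟩, t, fun i hi => ?_, rfl, htS⟩
  · rw [SetLike.mem_coe, mem_space_iff_repr hb]
    intro i hi
    by_cases hiS : i ∈ S
    · rw [hvx i hiS, hx i hi]
    · exact mem_finSpan.1 hv i hiS
  · by_cases hiS : i ∈ S
    · exact htS i hiS
    · rw [htx i hiS, hx i hi]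

/-- The part of `φ (closed a)` in the span of the basis vectors with index in `S`. -/
def imagePart (hW : W.Nontriv) (φ : flagMackey W b hW) (S : Finset ι) (a : A) : Submodule ℂ V :=
  finSpan b S ⊓ ((closed W b a).map φ.1.toLinearMap).comap (incl W b)

instance (hW : W.Nontriv) (φ : flagMackey W b hW) (S : Finset ι) (a : A) :
    FiniteDimensional ℂ (imagePart hW φ S a) :=
  Submodule.finiteDimensional_inf_left _ _

lemma imagePart_le (hW : W.Nontriv) (φ : flagMackey W b hW) (S : Finset ι) (a : A) :
    imagePart hW φ S a ≤ finSpan b S :=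
  inf_le_left

lemma Adapted.mem_map_closed (hb : W.Compatible b) {hW : W.Nontriv} {φ : flagMackey W b hW}
    {S : Finset ι} (h : Adapted hW φ S) {a : A} {t : VE W b} (ht : t ∈ closed W b a)
    (htS : ∀ i ∈ S, coordV W b t i = 0) : t ∈ (closed W b a).map φ.1.toLinearMap :=
  ⟨φ⁻¹.1 t, h.inv.map_mem_closed hb ht htS, φ.1.apply_symm_apply t⟩

/-- For an adapted `S`, the space `φ (closed a)` is the sum of its part in the span of `S` and of
the elements of `closed a` that vanish on `S`. -/
lemma Adapted.exists_decomp_map (hb : W.Compatible b) {hW : W.Nontriv} {φ : flagMackey W b hW}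
    {S : Finset ι} (h : Adapted hW φ S) {a : A} {x : VE W b} (hx : x ∈ closed W b a) :
    ∃ v ∈ imagePart hW φ S a, ∃ t ∈ closed W b a, φ.1 x = incl W b v + t ∧
      ∀ i ∈ S, coordV W b t i = 0 := by
  obtain ⟨v, hv, t, hvt, htS, -, htx⟩ := exists_decomp S (φ.1 x)
  have ht : t ∈ closed W b a := by
    intro i hi
    by_cases hiS : i ∈ S
    · exact htS i hiS
    · rw [htx i hiS, h.coordV_map_eq_zero hb hx hiS hi]
  refine ⟨v, ⟨hv, ?_⟩, t, ht, hvt, htS⟩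
  have : incl W b v = φ.1 x - t := by rw [hvt, add_sub_cancel_right]
  change incl W b v ∈ (closed W b a).map φ.1.toLinearMap
  rw [this]
  exact Submodule.sub_mem _ (Submodule.mem_map_of_mem hx) (h.mem_map_closed hb ht htS)

variable (W b) in
/-- The coordinates outside `W_a`. -/
def outer (a : A) : VE W b →ₗ[ℂ] ({i : ι // b i ∉ W.space a} → ℂ) :=
  LinearMap.funLeft ℂ ℂ Subtype.val ∘ₗ coordV W b

lemma outer_eq_zero {a : A} {x : VE W b} : outer W b a x = 0 ↔ x ∈ closed W b a :=
  ⟨fun h i hi => congrFun h ⟨i, hi⟩, fun h => funext fun i => h i.1 i.2⟩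

lemma finSpan_inf_space (hb : W.Compatible b) (S : Finset ι) (a : A) :
    finSpan b S ⊓ W.space a = Submodule.span ℂ (b '' {j | j ∈ S ∧ b j ∈ W.space a}) := by
  ext v
  rw [Submodule.mem_inf, mem_finSpan, mem_space_iff_repr hb, Basis.mem_span_image]
  constructor
  · rintro ⟨h, h'⟩ i hi
    have := Finsupp.mem_support_iff.1 hi
    exact ⟨by_contra fun hne => this (h i hne), by_contra fun hne => this (h' i hne)⟩
  · intro h
    exact ⟨fun i hi => by_contra fun hne => hi (h (Finsupp.mem_support_iff.2 hne)).1,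
      fun i hi => by_contra fun hne => hi (h (Finsupp.mem_support_iff.2 hne)).2⟩

/-- Only the columns with index in an adapted set contribute to the lower left blocks. -/
lemma Adapted.span_lowerBlock (hb : W.Compatible b) {hW : W.Nontriv} {φ : flagMackey W b hW}
    {S : Finset ι} (h : Adapted hW φ S) (a : A) :
    Submodule.span ℂ (Set.range (lowerBlock W b a (matrixOf W b hW φ)).col) =
      (finSpan b S ⊓ W.space a).map (outer W b a ∘ₗ φ.1.toLinearMap ∘ₗ incl W b) := by
  rw [finSpan_inf_space hb, Submodule.map_span]
  apply le_antisymm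
  · rw [Submodule.span_le]
    rintro _ ⟨⟨j, hj⟩, rfl⟩
    have hcol : (lowerBlock W b a (matrixOf W b hW φ)).col ⟨j, hj⟩ =
      outer W b a (φ.1 (incl W b (b j))) := rfl
    by_cases hjS : j ∈ S
    · exact Submodule.subset_span ⟨b j, ⟨j, ⟨hjS, hj⟩, rfl⟩, hcol.symm⟩
    · rw [hcol, outer_eq_zero.2]
      · exact Submodule.zero_mem _
      · classical
        refine h.map_mem_closed hb ((incl_mem_closed hb).2 hj) fun i hi => ?_
        rw [coordV_incl_basis, if_neg]
        rintro rfl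
        exact hjS hi
  · rw [Submodule.span_le]
    rintro _ ⟨_, ⟨j, ⟨-, hj⟩, rfl⟩, rfl⟩
    exact Submodule.subset_span ⟨⟨j, hj⟩, rfl⟩

lemma Adapted.map_outer (hb : W.Compatible b) {hW : W.Nontriv} {φ : flagMackey W b hW}
    {S : Finset ι} (h : Adapted hW φ S) (a : A) :
    (finSpan b S ⊓ W.space a).map (outer W b a ∘ₗ φ.1.toLinearMap ∘ₗ incl W b) =
      (imagePart hW φ S a).map (outer W b a ∘ₗ incl W b) := by
  apply le_antisymm
  · rintro _ ⟨v, hv, rfl⟩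
    obtain ⟨f, hf, t, ht, hft, -⟩ := h.exists_decomp_map hb ((incl_mem_closed hb).2 hv.2)
    refine ⟨f, hf, ?_⟩
    change outer W b a (incl W b f) = outer W b a (φ.1 (incl W b v))
    rw [hft, map_add, outer_eq_zero.2 ht, add_zero]
  · rintro _ ⟨f, ⟨hfS, x, hx, hxf⟩, rfl⟩
    obtain ⟨v, hv, t, ht, rfl, htS⟩ := exists_decomp_closed hb S hx
    refine ⟨v, hv, ?_⟩
    change outer W b a (φ.1 (incl W b v)) = outer W b a (incl W b f)
    rw [← hxf]
    change _ = outer W b a (φ.1 (incl W b v + t))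
    rw [map_add, map_add, outer_eq_zero.2 (h.map_mem_closed hb ht htS), add_zero]

/-- The ranks of the lower left blocks of `φ` and `φ⁻¹` are the codimensions of the same
intersection in the parts of `φ (closed a)` and of `W_a` that live on an adapted set. -/
lemma Adapted.cRank_eq_iff (hb : W.Compatible b) {hW : W.Nontriv} {φ : flagMackey W b hW}
    {S : Finset ι} (h : Adapted hW φ S) (a : A) :
    (lowerBlock W b a (matrixOf W b hW φ)).cRank =
        (lowerBlock W b a (matrixOf W b hW φ⁻¹)).cRank ↔
      finrank ℂ (finSpan b S ⊓ W.space a : Submodule ℂ V) = finrank ℂ (imagePart hW φ S a) := by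
  have : FiniteDimensional ℂ (finSpan b S ⊓ W.space a : Submodule ℂ V) :=
    Submodule.finiteDimensional_inf_left _ _
  have h1 := finrank_map_add_finrank_inf_ker (imagePart hW φ S a) (outer W b a ∘ₗ incl W b)
  have h2 := finrank_map_add_finrank_inf_ker (finSpan b S ⊓ W.space a)
    (outer W b a ∘ₗ (φ⁻¹).1.toLinearMap ∘ₗ incl W b)
  have hker : (finSpan b S ⊓ W.space a) ⊓
      LinearMap.ker (outer W b a ∘ₗ (φ⁻¹).1.toLinearMap ∘ₗ incl W b) =
      imagePart hW φ S a ⊓ LinearMap.ker (outer W b a ∘ₗ incl W b) := by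
    ext v
    have e1 : v ∈ LinearMap.ker (outer W b a ∘ₗ (φ⁻¹).1.toLinearMap ∘ₗ incl W b) ↔
        incl W b v ∈ (closed W b a).map φ.1.toLinearMap := by
      rw [LinearMap.mem_ker]
      refine outer_eq_zero.trans ⟨fun hv => ⟨_, hv, φ.1.apply_symm_apply _⟩, ?_⟩
      rintro ⟨x, hx, hxv⟩
      have : φ⁻¹.1 (φ.1 x) = x := φ.1.symm_apply_apply x
      change φ⁻¹.1 (incl W b v) ∈ closed W b a
      rw [← hxv]
      change φ⁻¹.1 (φ.1 x) ∈ closed W b a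
      rw [this]
      exact hx
    have e2 : v ∈ LinearMap.ker (outer W b a ∘ₗ incl W b) ↔ v ∈ W.space a := by
      rw [LinearMap.mem_ker]
      exact outer_eq_zero.trans (incl_mem_closed hb)
    rw [Submodule.mem_inf, Submodule.mem_inf, Submodule.mem_inf, e1, e2, imagePart,
      Submodule.mem_inf, Submodule.mem_comap]
    tauto
  rw [hker] at h2
  rw [Matrix.cRank, Matrix.cRank, h.span_lowerBlock hb, h.inv.span_lowerBlock hb, h.map_outer hb,
    ← finrank_eq_rank, ← finrank_eq_rank, Nat.cast_inj]
  omega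

end Stabilizer

/-! ### The product set and the eligible matrices -/

section Main

variable {A ι V : Type*} [LinearOrder A] [AddCommGroup V] [Module ℂ V]
  {W : GeneralizedFlag A V} {b : Basis ι ℂ V}

/-- The aligned inverse in the definition of eligibility is the matrix of the inverse operator. -/
lemma eligible_matrixOf_iff (hb : W.Compatible b) (hW : W.Nontriv) (φ : flagMackey W b hW) :
    Eligible W b (matrixOf W b hW φ) ↔
      Aligned W b (matrixOf W b hW φ) ∧ Aligned W b (matrixOf W b hW φ⁻¹) ∧
        ∀ a, (lowerBlock W b a (matrixOf W b hW φ)).cRank =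
          (lowerBlock W b a (matrixOf W b hW φ⁻¹)).cRank := by
  constructor
  · rintro ⟨hM, N, hN, hMN, hNM, hr⟩
    obtain ⟨ψ, hψ, hψ'⟩ := hM.exists_matrixOf_eq hb hW hN hMN hNM
    obtain rfl := matrixOf_injective hb hW hψ
    subst hψ'
    exact ⟨hM, hN, hr⟩
  · rintro ⟨hM, hN, hr⟩
    refine ⟨hM, _, hN, ?_, ?_, hr⟩
    · rw [← matrixOf_mul hb, mul_inv_cancel, matrixOf_one]
    · rw [← matrixOf_mul hb, inv_mul_cancel, matrixOf_one]

lemma eligible_matrixOf_inv (hb : W.Compatible b) (hW : W.Nontriv) {φ : flagMackey W b hW}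
    (h : Eligible W b (matrixOf W b hW φ)) : Eligible W b (matrixOf W b hW φ⁻¹) := by
  rw [eligible_matrixOf_iff hb] at h ⊢
  rw [inv_inv]
  exact ⟨h.2.1, h.1, fun a => (h.2.2 a).symm⟩

/-- Multiplying an element of the stabilizer on the left by a finitary operator modifies finitely
many rows, each of which has finitely many entries below the block diagonal. -/
lemma aligned_finitary_mul_stab (hb : W.Compatible b) (hW : W.Nontriv) {k s : flagMackey W b hW}
    {κ : V ≃ₗ[ℂ] V} (hκ : κ ∈ finitaryGL b) (hk : Extends W b hW k κ) (hs : s ∈ stab W b hW) :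
    Aligned W b (matrixOf W b hW (k * s)) := by
  obtain ⟨S, hS, -⟩ := exists_supportedOn hκ
  refine aligned_matrixOf hb hW _ ?_
  have hrow : ∀ i, {j | IsBelow W b i j ∧ matrixOf W b hW (k * s) i j ≠ 0}.Finite := by
    intro i
    obtain ⟨y, hy, -⟩ := exists_row hb hW (k * s) i
    rw [← hy]
    exact finite_isBelow_right y i
  refine (S.finite_toSet.biUnion fun i _ => (hrow i).image fun j => (i, j)).subset ?_
  rintro ⟨i, j⟩ ⟨hij, hne⟩
  have hi : i ∈ S := by
    by_contra hi
    apply hne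
    rw [matrixOf_apply]
    change coordV W b (k.1 (s.1 (incl W b (b j)))) i = 0
    rw [hk.coordV_apply hb hS _ hi]
    exact matrixOf_eq_zero_of_stab hb hW hs hij
  simp only [Set.mem_iUnion]
  exact ⟨i, hi, j, ⟨hij, hne⟩, rfl⟩

/-- Multiplying an element of the stabilizer on the right by a finitary operator modifies finitely
many columns, each of which has finitely many entries below the block diagonal. -/
lemma aligned_stab_mul_finitary (hb : W.Compatible b) (hW : W.Nontriv) {k s : flagMackey W b hW}
    {κ : V ≃ₗ[ℂ] V} (hκ : κ ∈ finitaryGL b) (hk : Extends W b hW k κ) (hs : s ∈ stab W b hW) :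
    Aligned W b (matrixOf W b hW (s * k)) := by
  have hfin : {j | κ (b j) ≠ b j}.Finite := hκ
  refine aligned_matrixOf hb hW _ ?_
  refine (hfin.biUnion fun j _ =>
    (finite_isBelow_left ((s * k).1 (incl W b (b j))) j).image fun i => (i, j)).subset ?_
  rintro ⟨i, j⟩ ⟨hij, hne⟩
  have hj : κ (b j) ≠ b j := by
    intro hj
    apply hne
    rw [matrixOf_apply]
    change coordV W b (s.1 (k.1 (incl W b (b j)))) i = 0
    rw [hk, hj]
    exact matrixOf_eq_zero_of_stab hb hW hs hij
  simp only [Set.mem_iUnion]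
  exact ⟨j, hj, i, ⟨hij, hne⟩, rfl⟩

lemma SupportedOn.map_mem_finSpan {S : Finset ι} {κ : V ≃ₗ[ℂ] V} (h : SupportedOn b S κ) {v : V}
    (hv : v ∈ finSpan b S) : κ v ∈ finSpan b S := by
  have : finSpan b S ≤ (finSpan b S).comap κ.toLinearMap := by
    conv_lhs => rw [finSpan]
    rw [Submodule.span_le]
    rintro _ ⟨j, hj, rfl⟩
    exact mem_finSpan.2 (h.2 j hj)
  exact this hv

/-- The matrices of the elements of `GL(E, V) · St_W` are eligible. -/
lemma eligible_of_mem_productSet (hb : W.Compatible b) (hW : W.Nontriv) {φ : flagMackey W b hW}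
    (h : φ ∈ productSet W b hW) : Eligible W b (matrixOf W b hW φ) := by
  classical
  obtain ⟨k, s, ⟨κ, hκ, hk⟩, hs, rfl⟩ := h
  have h1 := aligned_finitary_mul_stab hb hW hκ hk hs
  have h2 : Aligned W b (matrixOf W b hW (k * s)⁻¹) := by
    rw [mul_inv_rev]
    exact aligned_stab_mul_finitary hb hW (inv_mem hκ) hk.inv (inv_mem_stab hb hW hs)
  refine (eligible_matrixOf_iff hb hW _).2 ⟨h1, h2, fun a => ?_⟩
  obtain ⟨S₀, hS₀⟩ := exists_adapted h1 h2
  obtain ⟨S₁, hS₁, hS₁'⟩ := exists_supportedOn hκ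
  set S := S₀ ∪ S₁
  have hS := hS₁.mono (Finset.subset_union_right : S₁ ⊆ S₀ ∪ S₁)
  have hS' := hS₁'.mono (Finset.subset_union_right : S₁ ⊆ S₀ ∪ S₁)
  have hclosed : (closed W b a).map (k * s).1.toLinearMap =
      (closed W b a).map k.1.toLinearMap := by
    conv_rhs => rw [← (mem_stab_iff hb hW s).1 hs a]
    exact Submodule.map_comp _ _ _
  -- `κ` maps the part of `W_a` in the span of `S` onto that of `k (s (closed a))`
  have himage : (finSpan b S ⊓ W.space a).map κ.toLinearMap = imagePart hW (k * s) S a := by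
    rw [imagePart, hclosed]
    ext v
    constructor
    · rintro ⟨u, hu, rfl⟩
      exact ⟨hS.map_mem_finSpan hu.1, incl W b u, (incl_mem_closed hb).2 hu.2, hk u⟩
    · rintro ⟨hv, x, hx, hxv⟩
      have hx' : x = incl W b (κ⁻¹ v) := by
        rw [← hk.inv v, ← hxv]
        exact (k.1.symm_apply_apply x).symm
      refine ⟨κ⁻¹ v, ⟨hS'.map_mem_finSpan hv, ?_⟩, κ.apply_symm_apply v⟩
      rw [hx'] at hx
      exact (incl_mem_closed hb).1 hx
  rw [(hS₀ S Finset.subset_union_left).cRank_eq_iff hb, ← himage]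
  exact (LinearEquiv.finrank_map_eq κ _).symm

/-- An automorphism of the span of finitely many basis vectors extends to a finitary operator. -/
lemma exists_supportedOn_extends (b : Basis ι ℂ V) (S : Finset ι)
    (e : finSpan b S ≃ₗ[ℂ] finSpan b S) :
    ∃ κ : V ≃ₗ[ℂ] V, SupportedOn b S κ ∧ ∀ v : finSpan b S, κ v = e v := by
  have hc : IsCompl (finSpan b S) (Submodule.span ℂ (b '' (S : Set ι)ᶜ)) := by
    constructor
    · exact b.linearIndependent.disjoint_span_image disjoint_compl_right
    · rw [codisjoint_iff, finSpan, ← Submodule.span_union, ← Set.image_union,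
        Set.union_compl_self, Set.image_univ, b.span_eq]
  obtain ⟨κ, h1, h2⟩ := exists_equiv_of_isCompl hc hc e (LinearEquiv.refl ℂ _)
  refine ⟨κ, ⟨fun j hj => ?_, fun j hj i hi => ?_⟩, h1⟩
  · exact h2 ⟨b j, Submodule.subset_span ⟨j, hj, rfl⟩⟩
  · have := h1 ⟨b j, Submodule.subset_span ⟨j, hj, rfl⟩⟩
    change κ (b j) = _ at this
    rw [this]
    exact mem_finSpan.1 (e _).2 i hi

/-- An element of the Mackey group with eligible matrix lies in `GL(E, V) · St_W`: on an adapted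
finite set of basis vectors, the flags cut out by `W` and by its image have the same dimensions. -/
lemma mem_productSet_of_eligible (hb : W.Compatible b) (hW : W.Nontriv) {φ : flagMackey W b hW}
    (h : Eligible W b (matrixOf W b hW φ)) : φ ∈ productSet W b hW := by
  rw [eligible_matrixOf_iff hb] at h
  obtain ⟨h1, h2, hr⟩ := h
  obtain ⟨S, hS₀⟩ := exists_adapted h1 h2
  have hS := hS₀ S subset_rfl
  have hdim := fun a => (hS.cRank_eq_iff hb a).1 (hr a)
  have himage : Monotone (imagePart hW φ S) := fun a c hac =>
    inf_le_inf_left _ (Submodule.comap_mono (Submodule.map_mono fun x hx i hi =>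
      hx i fun h => hi (W.strictMono.monotone hac h)))
  obtain ⟨e, he⟩ := exists_equiv_map_flag (finrank ℂ (finSpan b S)) rfl rfl
    (fun a => (W.space a).comap (finSpan b S).subtype)
    (fun a => (imagePart hW φ S a).comap (finSpan b S).subtype)
    (fun a c hac => Submodule.comap_mono (W.strictMono.monotone hac))
    (fun a c hac => Submodule.comap_mono (himage hac))
    (fun a => by
      rw [finrank_comap_subtype_of_le (imagePart_le hW φ S a), ← hdim a,
        ← finrank_comap_subtype_of_le (inf_le_left : finSpan b S ⊓ W.space a ≤ finSpan b S),
        Submodule.comap_inf, Submodule.comap_subtype_self, top_inf_eq])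
  obtain ⟨κ, hκS, hκe⟩ := exists_supportedOn_extends b S e
  have hκ : κ ∈ finitaryGL b := S.finite_toSet.subset fun j hj => by
    by_contra hjS
    exact hj (hκS.1 j hjS)
  obtain ⟨k, hk, -⟩ := existsUnique_extends hb hW hκ
  have hmap : ∀ a, (closed W b a).map k.1.toLinearMap = (closed W b a).map φ.1.toLinearMap := by
    intro a
    apply le_antisymm
    · rintro _ ⟨x, hx, rfl⟩
      obtain ⟨v, hv, t, ht, rfl, htS⟩ := exists_decomp_closed hb S hx
      change k.1 (incl W b v + t) ∈ _
      rw [map_add, hk, hk.apply_eq_self hb hκS htS]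
      refine Submodule.add_mem _ ?_ (hS.mem_map_closed hb ht htS)
      have : e ⟨v, hv.1⟩ ∈ (imagePart hW φ S a).comap (finSpan b S).subtype := by
        rw [← he a]
        exact ⟨⟨v, hv.1⟩, hv.2, rfl⟩
      have hev := hκe ⟨v, hv.1⟩
      change κ v = _ at hev
      rw [hev]
      exact this.2
    · rintro _ ⟨x, hx, rfl⟩
      obtain ⟨f, hf, t, ht, hft, htS⟩ := hS.exists_decomp_map hb hx
      have hf' : (⟨f, hf.1⟩ : finSpan b S) ∈
          (imagePart hW φ S a).comap (finSpan b S).subtype := hf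
      rw [← he a] at hf'
      obtain ⟨v, hv, hvf⟩ := hf'
      refine ⟨incl W b v + t, Submodule.add_mem _ ((incl_mem_closed hb).2 hv) ht, ?_⟩
      change k.1 (incl W b v + t) = φ.1 x
      rw [map_add, hk, hk.apply_eq_self hb hκS htS, hft, hκe]
      have : (e v : V) = f := congrArg Subtype.val hvf
      rw [this]
  refine ⟨k, k⁻¹ * φ, ⟨κ, hκ, hk⟩, ?_, (mul_inv_cancel_left k φ).symm⟩
  rw [mem_stab_iff hb]
  intro a
  have hcomp : (closed W b a).map (k⁻¹ * φ).1.toLinearMap =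
      ((closed W b a).map φ.1.toLinearMap).map (k⁻¹).1.toLinearMap := Submodule.map_comp _ _ _
  have hcomp' : (closed W b a).map (k⁻¹ * k).1.toLinearMap =
      ((closed W b a).map k.1.toLinearMap).map (k⁻¹).1.toLinearMap := Submodule.map_comp _ _ _
  rw [hcomp, ← hmap a, ← hcomp', inv_mul_cancel]
  exact Submodule.map_id _

lemma mem_productSet_iff (hb : W.Compatible b) (hW : W.Nontriv) (φ : flagMackey W b hW) :
    φ ∈ productSet W b hW ↔ Eligible W b (matrixOf W b hW φ) :=
  ⟨eligible_of_mem_productSet hb hW, mem_productSet_of_eligible hb hW⟩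

lemma inv_mem_productSet (hb : W.Compatible b) (hW : W.Nontriv) {φ : flagMackey W b hW}
    (h : φ ∈ productSet W b hW) : φ⁻¹ ∈ productSet W b hW :=
  (mem_productSet_iff hb hW _).2 (eligible_matrixOf_inv hb hW ((mem_productSet_iff hb hW _).1 h))

lemma Extends.mul {hW : W.Nontriv} {φ ψ : flagMackey W b hW} {κ κ' : V ≃ₗ[ℂ] V}
    (h : Extends W b hW φ κ) (h' : Extends W b hW ψ κ') : Extends W b hW (φ * ψ) (κ * κ') :=
  fun v => (congrArg φ.1 (h' v)).trans (h _)

/-- `GL(E, V) · St_W` is closed under products because `St_W · GL(E, V)`, the set of inverses of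
its elements, is the same set. -/
lemma mul_mem_productSet (hb : W.Compatible b) (hW : W.Nontriv) {φ ψ : flagMackey W b hW}
    (h : φ ∈ productSet W b hW) (h' : ψ ∈ productSet W b hW) : φ * ψ ∈ productSet W b hW := by
  obtain ⟨k, s, ⟨κ, hκ, hk⟩, hs, rfl⟩ := h
  obtain ⟨k', s', ⟨κ', hκ', hk'⟩, hs', rfl⟩ := h'
  have hsk : s * k' ∈ productSet W b hW := by
    have := inv_mem_productSet hb hW (φ := k'⁻¹ * s⁻¹)
      ⟨_, _, ⟨κ'⁻¹, inv_mem hκ', hk'.inv⟩, inv_mem_stab hb hW hs, rfl⟩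
    rwa [mul_inv_rev, inv_inv, inv_inv] at this
  obtain ⟨k₂, s₂, ⟨κ₂, hκ₂, hk₂⟩, hs₂, h₂⟩ := hsk
  refine ⟨k * k₂, s₂ * s', ⟨κ * κ₂, mul_mem hκ hκ₂, hk.mul hk₂⟩, mul_mem_stab hb hW hs₂ hs', ?_⟩
  calc k * s * (k' * s') = k * (s * k') * s' := by group
    _ = k * k₂ * (s₂ * s') := by rw [h₂]; group

lemma one_mem_productSet (hb : W.Compatible b) (hW : W.Nontriv) :
    (1 : flagMackey W b hW) ∈ productSet W b hW :=
  ⟨1, 1, ⟨1, one_mem _, fun _ => rfl⟩,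
    (mem_stab_iff hb hW _).2 fun _ => Submodule.map_id _, (mul_one _).symm⟩

/-- The product set `GL(E, V) · St_W` as a subgroup of the Mackey group. -/
def productSubgroup (hb : W.Compatible b) (hW : W.Nontriv) : Subgroup (flagMackey W b hW) where
  carrier := productSet W b hW
  one_mem' := one_mem_productSet hb hW
  mul_mem' := mul_mem_productSet hb hW
  inv_mem' := inv_mem_productSet hb hW

/-- The bijection between `GL(E, V) · St_W` and the eligible matrices. -/
def productEquiv (hb : W.Compatible b) (hW : W.Nontriv) :
    productSubgroup hb hW ≃ EligibleMatrix W b :=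
  Equiv.ofBijective
    (fun φ => ⟨matrixOf W b hW φ.1, eligible_of_mem_productSet hb hW φ.2⟩) (by
      constructor
      · intro φ ψ h
        exact Subtype.ext (matrixOf_injective hb hW (congrArg Subtype.val h))
      · rintro ⟨M, hM⟩
        obtain ⟨hM₁, N, hN, hMN, hNM, -⟩ := id hM
        obtain ⟨φ, rfl, -⟩ := hM₁.exists_matrixOf_eq hb hW hN hMN hNM
        exact ⟨⟨φ, mem_productSet_of_eligible hb hW hM⟩, rfl⟩)

lemma productEquiv_apply (hb : W.Compatible b) (hW : W.Nontriv) (φ : productSubgroup hb hW) :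
    (productEquiv hb hW φ).1 = matrixOf W b hW φ.1 := rfl

end Main

end GenFlag

end

theorem theorem5p1 {A ι V : Type*} [LinearOrder A] [Countable ι] [Infinite ι]
    [AddCommGroup V] [Module ℂ V] (b : Module.Basis ι ℂ V)
    (W : GenFlag.GeneralizedFlag A V) (hb : W.Compatible b) (hW : W.Nontriv) :
    (∀ κ ∈ GenFlag.finitaryGL b,
      ∃! φ : GenFlag.flagMackey W b hW, GenFlag.Extends W b hW φ κ) ∧
    ∃ H : Subgroup (GenFlag.flagMackey W b hW),
      (H : Set (GenFlag.flagMackey W b hW)) = GenFlag.productSet W b hW ∧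
      ∃ _ : Group (GenFlag.EligibleMatrix W b),
        (∀ M N : GenFlag.EligibleMatrix W b, ∀ i k,
          (Function.support fun j => M.1 i j * N.1 j k).Finite) ∧
        (∀ M N : GenFlag.EligibleMatrix W b, (M * N).1 = GenFlag.mulMat M.1 N.1) ∧
        (1 : GenFlag.EligibleMatrix W b).1 = GenFlag.idMat ι ∧
        ∃ e : H ≃* GenFlag.EligibleMatrix W b,
          ∀ φ : H, (e φ).1 = GenFlag.matrixOf W b hW φ.1 := by
  -- the group structure on the eligible matrices is transported from the product set
  let _ : Group (GenFlag.EligibleMatrix W b) := (GenFlag.productEquiv hb hW).symm.group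
  let e : GenFlag.productSubgroup hb hW ≃* GenFlag.EligibleMatrix W b :=
    (GenFlag.productEquiv hb hW).symm.mulEquiv.symm
  have he : ∀ φ, (e φ).1 = GenFlag.matrixOf W b hW φ.1 := fun φ =>
    GenFlag.productEquiv_apply hb hW φ
  have hmul : ∀ φ ψ, (e φ * e ψ).1 = GenFlag.matrixOf W b hW (φ.1 * ψ.1) := fun φ ψ =>
    (congrArg Subtype.val (e.map_mul φ ψ)).symm.trans (he (φ * ψ))
  have hone : (1 : GenFlag.EligibleMatrix W b).1 = GenFlag.matrixOf W b hW 1 :=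
    (congrArg Subtype.val e.map_one).symm.trans (he 1)
  clear_value e
  refine ⟨fun κ hκ => GenFlag.existsUnique_extends hb hW hκ, GenFlag.productSubgroup hb hW, rfl,
    _, fun M N i k => ?_, fun M N => ?_, hone.trans (GenFlag.matrixOf_one hW), e, he⟩
  · obtain ⟨φ, rfl⟩ := e.surjective M
    obtain ⟨ψ, rfl⟩ := e.surjective N
    rw [he, he]
    exact GenFlag.matrixOf_mul_support_finite hb hW φ.1 ψ.1 i k
  · obtain ⟨φ, rfl⟩ := e.surjective M
    obtain ⟨ψ, rfl⟩ := e.surjective N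
    exact (hmul φ ψ).trans ((GenFlag.matrixOf_mul hb hW φ.1 ψ.1).trans
      (congrArg₂ GenFlag.mulMat (he φ).symm (he ψ).symm))
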